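/- \textbf{Theorem.} Let $X$ be an at most countable set, let $m\colon X\to(0,\infty)$, extended to a measure on $X$ by additivity, satisfy $m(X)<\infty$, and write $\|\cdot\|_p$ for the norm of the complex space $\ell^p(X,m)$. Let $Q$ be a Dirichlet form on $\ell^2(X,m)$, i.e.\ a densely defined, closed, nonnegative quadratic form with domain $D(Q)$ such that $C\circ u\in D(Q)$ and $Q(C\circ u)\le Q(u)$ for all $u\in D(Q)$ and all maps $C\colon\mathbb C\to\mathbb C$ with $C(0)=0$ and $|C(s)-C(t)|\le|s-t|$ for all $s,t\in\mathbb C$. Let $L$ be its generator, i.e.\ the nonnegative self-adjoint operator associated with $Q$: $u\in D(L)$ and $Lu=g$ if and only if $u\in D(Q)$ and $Q(u,v)=\langle g,v\rangle$ for all $v\in D(Q)$. Let $p\in(2,\infty]$ and suppose that there is a constant $S\geq 0$ with $\|u\|_p^2\le S\,Q(u)$ for all $u\in D(Q)$; let $S_p(Q)$ be the smallest such constant. Then the operator $e^{-tL}$ is trace class for every $t>0$. Moreover, the spectrum of $L$ is discrete, i.e.\ it consists of isolated eigenvalues of finite multiplicity. Finally, let $\lambda_1\le\lambda_2\le\dots$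 be the eigenvalues of $L$ in increasing order, counted with multiplicity. Then for every integer $k\ge1$ (with $k\le|X|$ if $X$ is finite), $$\frac1k\sum_{i=1}^k\lambda_i\ \ge\ \frac1{e\,S_p(Q)}\left(\frac{k}{m(X)}\right)^{1-\frac2p} \qquad\text{and}\qquad \lambda_k\ \ge\ \frac1{e\,S_p(Q)}\left(\frac{k}{m(X)}\right)^{1-\frac2p},$$ where $2/p=0$ if $p=\infty$. -/

import Mathlib

open scoped ENNReal InnerProductSpace ComplexConjugate

/-! ### Operators on a Hilbert space: trace class, resolvent set, discrete spectrum, eigenvalues -/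

section Operators

variable {H : Type*} [NormedAddCommGroup H] [InnerProductSpace ℂ H]

/-- A bounded operator `T` is trace class if `∑ ⟨b i, |T| b i⟩ < ∞` for every orthonormal basis `b`
(every orthonormal basis can be indexed by the set of its elements), where `|T| = (T* T)^{1/2}`. -/
def IsTraceClass [CompleteSpace H] (T : H →L[ℂ] H) : Prop :=
  ∀ (w : Set H) (b : HilbertBasis w ℂ H), Summable fun i => (⟪b i, CFC.abs T (b i)⟫_ℂ).re

/-- The resolvent set of an (unbounded) operator `A`: those `z` for which `A - z` has a bounded,
everywhere defined two-sided inverse. -/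
def opResolventSet (A : H →ₗ.[ℂ] H) : Set ℂ :=
  {z | ∃ R : H →L[ℂ] H,
    (∀ f : H, ∃ h : R f ∈ A.domain, A ⟨R f, h⟩ - z • R f = f) ∧
    (∀ u : A.domain, R (A u - z • (u : H)) = u)}

/-- The spectrum of an (unbounded) operator. -/
def opSpectrum (A : H →ₗ.[ℂ] H) : Set ℂ := (opResolventSet A)ᶜ

/-- The eigenspace `ker (A - z)` of an (unbounded) operator. -/
def opEigenspace (A : H →ₗ.[ℂ] H) (z : ℂ) : Submodule ℂ H where
  carrier := {u | ∃ h : u ∈ A.domain, A ⟨u, h⟩ = z • u}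
  add_mem' := by
    rintro u v ⟨hu, hu'⟩ ⟨hv, hv'⟩
    refine ⟨A.domain.add_mem hu hv, ?_⟩
    have := A.map_add ⟨u, hu⟩ ⟨v, hv⟩
    rw [hu', hv', ← smul_add] at this
    exact this
  zero_mem' := ⟨A.domain.zero_mem, by
    have := A.map_zero
    rw [smul_zero]
    exact this⟩
  smul_mem' := by
    rintro c u ⟨hu, hu'⟩
    refine ⟨A.domain.smul_mem c hu, ?_⟩
    have := A.map_smul c ⟨u, hu⟩
    rw [hu', smul_comm] at this
    exact this

/-- The spectrum is (purely) discrete: every point of it is an isolated point of the spectrum and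
an eigenvalue of finite multiplicity. -/
def HasDiscreteSpectrum (A : H →ₗ.[ℂ] H) : Prop :=
  ∀ z ∈ opSpectrum A,
    (∃ ε : ℝ, 0 < ε ∧ ∀ w ∈ opSpectrum A, dist w z < ε → w = z) ∧
    opEigenspace A z ≠ ⊥ ∧ FiniteDimensional ℂ (opEigenspace A z)

/-- The number `N(t)` of eigenvalues of `A` that are real and at most `t`, counted with
multiplicity: the dimension of the span of the corresponding eigenspaces. -/
noncomputable def eigenvalueCount (A : H →ₗ.[ℂ] H) (t : ℝ) : Cardinal :=
  Module.rank ℂ ↥(⨆ s : Set.Iic t, opEigenspace A ((s : ℝ) : ℂ))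

/-- The `k`-th eigenvalue (`k = 1, 2, …`), in increasing order and counted with multiplicity:
the smallest `t` such that at least `k` eigenvalues are at most `t`. -/
noncomputable def eigenvalueNth (A : H →ₗ.[ℂ] H) (k : ℕ) : ℝ :=
  sInf {t : ℝ | (k : Cardinal) ≤ eigenvalueCount A t}

end Operators

/-! ### Closed forms, their generators and heat semigroups -/

/-- A densely defined, closed, nonnegative Hermitian form on a complex Hilbert space
(conjugate linear in the first variable). -/
structure ClosedForm (H : Type*) [NormedAddCommGroup H] [InnerProductSpace ℂ H] where
  /-- the form domain `D(Q)` -/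
  domain : Submodule ℂ H
  /-- the sesquilinear form; the quadratic form is its diagonal -/
  form : domain →ₗ⋆[ℂ] domain →ₗ[ℂ] ℂ
  dense_domain : Dense (domain : Set H)
  hermitian : ∀ u v, conj (form v u) = form u v
  nonneg : ∀ u, 0 ≤ (form u u).re
  /-- closedness: if `u n ∈ D(Q)` converges to `u` in `H` and is Cauchy for `Q`, then `u ∈ D(Q)` and
  `Q (u n - u) → 0` -/
  closed : ∀ (u : ℕ → domain) (v : H),
    (∀ ε : ℝ, 0 < ε → ∃ N, ∀ i ≥ N, ∀ j ≥ N, (form (u i - u j) (u i - u j)).re < ε) →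
    Filter.Tendsto (fun n => (u n : H)) Filter.atTop (nhds v) →
    ∃ hv : v ∈ domain,
      Filter.Tendsto (fun n => (form (u n - ⟨v, hv⟩) (u n - ⟨v, hv⟩)).re) Filter.atTop (nhds 0)

namespace ClosedForm

variable {H : Type*} [NormedAddCommGroup H] [InnerProductSpace ℂ H] (Q : ClosedForm H)

/-- The quadratic form `Q(u)`, for `u ∈ D(Q)`. -/
def quad (u : Q.domain) : ℝ := (Q.form u u).re

/-- The graph of the generator: the pairs `(u, g)` with `u ∈ D(Q)` and `Q(u, v) = ⟨g, v⟩` for all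
`v ∈ D(Q)`. -/
def generatorGraph : Submodule ℂ (H × H) where
  carrier := {x | ∃ h : x.1 ∈ Q.domain, ∀ v : Q.domain, Q.form ⟨x.1, h⟩ v = ⟪x.2, (v : H)⟫_ℂ}
  add_mem' := by
    rintro x y ⟨hx, hx'⟩ ⟨hy, hy'⟩
    refine ⟨Q.domain.add_mem hx hy, fun v => ?_⟩
    have : (⟨(x + y).1, Q.domain.add_mem hx hy⟩ : Q.domain) = ⟨x.1, hx⟩ + ⟨y.1, hy⟩ := rfl
    rw [this, map_add, LinearMap.add_apply, hx', hy', Prod.snd_add, inner_add_left]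
  zero_mem' := by
    refine ⟨Q.domain.zero_mem, fun v => ?_⟩
    have : (⟨(0 : H × H).1, Q.domain.zero_mem⟩ : Q.domain) = 0 := rfl
    rw [this, map_zero, LinearMap.zero_apply, Prod.snd_zero, inner_zero_left]
  smul_mem' := by
    rintro c x ⟨hx, hx'⟩
    refine ⟨Q.domain.smul_mem c hx, fun v => ?_⟩
    have : (⟨(c • x).1, Q.domain.smul_mem c hx⟩ : Q.domain) = c • ⟨x.1, hx⟩ := rfl
    rw [this, LinearMap.map_smulₛₗ, LinearMap.smul_apply, hx', Prod.smul_snd, inner_smul_left,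
      smul_eq_mul]

/-- The generator `L` of the form `Q`, i.e. the self-adjoint operator associated with `Q`: its
domain consists of the `u ∈ D(Q)` for which there is `g` with `Q(u, v) = ⟨g, v⟩` for all
`v ∈ D(Q)`, and then `L u = g`. -/
noncomputable def generator : H →ₗ.[ℂ] H := Q.generatorGraph.toLinearPMap

theorem mem_generatorGraph {x : H × H} : x ∈ Q.generatorGraph ↔
    ∃ h : x.1 ∈ Q.domain, ∀ v : Q.domain, Q.form ⟨x.1, h⟩ v = ⟪x.2, (v : H)⟫_ℂ := Iff.rfl

theorem graph_generator : Q.generator.graph = Q.generatorGraph := by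
  refine Submodule.toLinearPMap_graph_eq _ ?_
  rintro ⟨u, g⟩ ⟨h, hv⟩ (rfl : u = 0)
  have h0 : (⟨(0, g).1, h⟩ : Q.domain) = 0 := rfl
  refine Q.dense_domain.eq_zero_of_inner_left ℂ fun v hv' => ?_
  have := hv ⟨v, hv'⟩
  rw [h0, map_zero, LinearMap.zero_apply] at this
  exact this.symm

/-- The form domain as a type, to be equipped with the form norm `(Q(u) + ‖u‖²)^{1/2}`. -/
def FormDomain : Type _ := Q.domain

instance : AddCommGroup Q.FormDomain := inferInstanceAs (AddCommGroup Q.domain)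

instance : Module ℂ Q.FormDomain := inferInstanceAs (Module ℂ Q.domain)

/-- The identity map from the type `FormDomain` to `D(Q)`. -/
def toDomain : Q.FormDomain ≃ₗ[ℂ] Q.domain := LinearEquiv.refl ℂ Q.domain

/-- The inner product `Q(u, v) + ⟨u, v⟩` on the form domain. -/
noncomputable abbrev formCore : InnerProductSpace.Core ℂ Q.FormDomain where
  inner u v := Q.form (Q.toDomain u) (Q.toDomain v) + ⟪(Q.toDomain u : H), (Q.toDomain v : H)⟫_ℂ
  conj_inner_symm u v := by
    rw [map_add, inner_conj_symm, Q.hermitian]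
  re_inner_nonneg u := by
    rw [map_add]
    exact add_nonneg (Q.nonneg _) inner_self_nonneg
  add_left u v w := by
    rw [map_add, map_add, LinearMap.add_apply, Submodule.coe_add, inner_add_left]
    ring
  smul_left u v c := by
    rw [map_smul, LinearMap.map_smulₛₗ, LinearMap.smul_apply, Submodule.coe_smul, inner_smul_left,
      smul_eq_mul, mul_add]
  definite u h := by
    have h1 : (Q.form (Q.toDomain u) (Q.toDomain u)).re + ‖(Q.toDomain u : H)‖ ^ 2 = 0 := by
      have := congrArg Complex.re h
      rw [Complex.add_re, Complex.zero_re] at this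
      rw [← this, ← inner_self_eq_norm_sq (𝕜 := ℂ)]
      rfl
    have h2 : ‖(Q.toDomain u : H)‖ ^ 2 = 0 :=
      le_antisymm (by linarith [Q.nonneg (Q.toDomain u)]) (sq_nonneg _)
    have h3 : (Q.toDomain u : H) = 0 := by simpa using h2
    exact Q.toDomain.map_eq_zero_iff.1 (Subtype.ext h3)

noncomputable instance : NormedAddCommGroup Q.FormDomain :=
  Q.formCore.toNormedAddCommGroup

noncomputable instance : InnerProductSpace ℂ Q.FormDomain :=
  InnerProductSpace.ofCore Q.formCore.toCore

theorem formDomain_inner (u v : Q.FormDomain) : ⟪u, v⟫_ℂ =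
    Q.form (Q.toDomain u) (Q.toDomain v) + ⟪(Q.toDomain u : H), (Q.toDomain v : H)⟫_ℂ := by
  rfl

theorem formDomain_norm_sq (u : Q.FormDomain) :
    ‖u‖ ^ 2 = (Q.form (Q.toDomain u) (Q.toDomain u)).re + ‖(Q.toDomain u : H)‖ ^ 2 := by
  rw [← inner_self_eq_norm_sq (𝕜 := ℂ), formDomain_inner,
    ← inner_self_eq_norm_sq (𝕜 := ℂ) (Q.toDomain u : H), map_add]
  rfl

/-- The inclusion of the form domain, with the form norm, into `H`. -/
noncomputable def incl : Q.FormDomain →L[ℂ] H :=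
  LinearMap.mkContinuous (Q.domain.subtype ∘ₗ Q.toDomain.toLinearMap) 1 (fun u => by
    rw [one_mul]
    refine le_of_sq_le_sq ?_ (norm_nonneg _)
    rw [formDomain_norm_sq]
    exact le_add_of_nonneg_left (Q.nonneg _))

theorem incl_apply (u : Q.FormDomain) : Q.incl u = (Q.toDomain u : H) := rfl

instance [CompleteSpace H] : CompleteSpace Q.FormDomain := by
  refine Metric.complete_of_cauchySeq_tendsto fun u hu => ?_
  obtain ⟨v, hv⟩ := cauchySeq_tendsto_of_complete (Q.incl.uniformContinuous.comp_cauchySeq hu)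
  obtain ⟨hvD, hlim⟩ := Q.closed (fun n => Q.toDomain (u n)) v (fun ε hε => by
    obtain ⟨N, hN⟩ := Metric.cauchySeq_iff.1 hu (Real.sqrt ε) (Real.sqrt_pos.2 hε)
    refine ⟨N, fun i hi j hj => ?_⟩
    have h := hN i hi j hj
    rw [dist_eq_norm] at h
    rw [← map_sub]
    calc (Q.form (Q.toDomain (u i - u j)) (Q.toDomain (u i - u j))).re ≤ ‖u i - u j‖ ^ 2 := by
          rw [formDomain_norm_sq]
          exact le_add_of_nonneg_right (sq_nonneg _)
      _ < Real.sqrt ε ^ 2 := by gcongr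
      _ = ε := Real.sq_sqrt hε.le) hv
  refine ⟨Q.toDomain.symm ⟨v, hvD⟩, ?_⟩
  rw [tendsto_iff_norm_sub_tendsto_zero]
  have h1 : Filter.Tendsto (fun n => ‖Q.incl (u n) - v‖ ^ 2) Filter.atTop (nhds 0) := by
    simpa using ((tendsto_iff_norm_sub_tendsto_zero.1 hv).pow 2)
  have h2 := (hlim.add h1).sqrt
  rw [add_zero, Real.sqrt_zero] at h2
  refine h2.congr fun n => ?_
  rw [← Real.sqrt_sq (norm_nonneg (u n - _)), formDomain_norm_sq]
  rfl

variable [CompleteSpace H]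

/-- The resolvent `(1 + L)⁻¹`. -/
noncomputable def resolventOne : H →L[ℂ] H := Q.incl ∘L Q.incl.adjoint

/-- `resolventOne` is the inverse of `1 + L`. -/
theorem resolventOne_eq_iff (f u : H) :
    Q.resolventOne f = u ↔ (u, f - u) ∈ Q.generator.graph := by
  have key : ∀ w : Q.FormDomain, Q.incl.adjoint f = w ↔ ∀ v : Q.domain,
      Q.form (Q.toDomain w) v = ⟪f - Q.toDomain w, (v : H)⟫_ℂ := fun w => by
    have h : ∀ v : Q.FormDomain, ⟪Q.incl.adjoint f, v⟫_ℂ = ⟪w, v⟫_ℂ ↔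
        Q.form (Q.toDomain w) (Q.toDomain v) = ⟪f - Q.toDomain w, (Q.toDomain v : H)⟫_ℂ :=
      fun v => by
        rw [ContinuousLinearMap.adjoint_inner_left, formDomain_inner, inner_sub_left,
          eq_sub_iff_add_eq, eq_comm, incl_apply]
    refine ⟨fun e v => ?_, fun e => ext_inner_right ℂ fun v => (h v).2 (e _)⟩
    have := (h (Q.toDomain.symm v)).1 (by rw [e])
    rwa [LinearEquiv.apply_symm_apply] at this
  rw [graph_generator, mem_generatorGraph]
  constructor
  · rintro rfl
    exact ⟨(Q.toDomain (Q.incl.adjoint f)).2, (key _).1 rfl⟩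
  · rintro ⟨hu, h⟩
    have := (key (Q.toDomain.symm ⟨u, hu⟩)).2 (by rwa [LinearEquiv.apply_symm_apply])
    rw [resolventOne, ContinuousLinearMap.comp_apply, this, incl_apply,
      LinearEquiv.apply_symm_apply]

/-- The function of `r = (1 + l)⁻¹` that represents `e^{-t l}`, namely `e^{-t (1/r - 1)}`, with the
limiting value `0` at `r = 0` (which corresponds to `l = ∞`). -/
noncomputable def heatSymbol (t r : ℝ) : ℝ := if r ≤ 0 then 0 else Real.exp (-t * (r⁻¹ - 1))

theorem heatSymbol_one_add_inv (t l : ℝ) (hl : 0 ≤ l) :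
    heatSymbol t (1 + l)⁻¹ = Real.exp (-t * l) := by
  have h : ¬ (1 + l)⁻¹ ≤ 0 := by
    rw [not_le]
    positivity
  rw [heatSymbol, if_neg h, inv_inv, add_sub_cancel_left]

theorem continuous_heatSymbol (t : ℝ) (ht : 0 < t) : Continuous (heatSymbol t) := by
  have h : heatSymbol t = fun r => Real.exp t * expNegInvGlue (r * t⁻¹) := by
    funext r
    by_cases hr : r ≤ 0
    · rw [heatSymbol, if_pos hr,
        expNegInvGlue.zero_of_nonpos (mul_nonpos_of_nonpos_of_nonneg hr (inv_nonneg.2 ht.le)),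
        mul_zero]
    · have hr' : ¬ r * t⁻¹ ≤ 0 := not_le.2 (mul_pos (not_le.1 hr) (inv_pos.2 ht))
      rw [heatSymbol, if_neg hr, expNegInvGlue, if_neg hr', ← Real.exp_add, mul_inv, inv_inv]
      congr 1
      ring
  rw [h]
  exact continuous_const.mul ((expNegInvGlue.contDiff (n := 0)).continuous.comp
    (continuous_id.mul continuous_const))

theorem isSelfAdjoint_resolventOne : IsSelfAdjoint Q.resolventOne :=
  (ContinuousLinearMap.isPositive_self_comp_adjoint Q.incl).isSelfAdjoint

/-- The heat semigroup `e^{-tL}`, `t > 0`, by the continuous functional calculus of the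
self-adjoint operator `(1 + L)⁻¹`. -/
noncomputable def heatSemigroup (t : ℝ) : H →L[ℂ] H := cfc (heatSymbol t) Q.resolventOne

end ClosedForm

/-! ### Discrete measure spaces, Dirichlet forms and Sobolev inequalities -/

/-- The measure on `X` with point masses `m x`. -/
noncomputable def discreteMeasure {X : Type*} [MeasurableSpace X] (m : X → ℝ) :
    MeasureTheory.Measure X :=
  MeasureTheory.Measure.sum fun x => ENNReal.ofReal (m x) • MeasureTheory.Measure.dirac x

/-- The complex Hilbert space `ℓ²(X, m)`. -/
abbrev L2 {X : Type*} [MeasurableSpace X] (m : X → ℝ) : Type _ :=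
  MeasureTheory.Lp ℂ 2 (discreteMeasure m)

/-- A Dirichlet form on `ℓ²(X, m)`: a densely defined closed form such that `C ∘ u ∈ D(Q)` and
`Q(C ∘ u) ≤ Q(u)` for all `u ∈ D(Q)` and all normal contractions `C : ℂ → ℂ`. -/
structure DirichletForm {X : Type*} [MeasurableSpace X] (m : X → ℝ) extends
    ClosedForm (L2 m) where
  contraction : ∀ (C : ℂ → ℂ) (hC : LipschitzWith 1 C) (hC0 : C 0 = 0) (u : domain),
    ∃ h : hC.compLp hC0 (u : L2 m) ∈ domain,
      (form ⟨_, h⟩ ⟨_, h⟩).re ≤ (form u u).re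

namespace DirichletForm

variable {X : Type*} [MeasurableSpace X] {m : X → ℝ} (Q : DirichletForm m)

/-- `‖u‖_p² ≤ S · Q(u)` for all `u ∈ D(Q)`, with the constant `S ≥ 0`. -/
def SobolevWith (p : ℝ≥0∞) (S : ℝ) : Prop :=
  0 ≤ S ∧ ∀ u : Q.domain, MeasureTheory.eLpNorm (u : L2 m) p (discreteMeasure m) ^ 2 ≤
    ENNReal.ofReal (S * Q.quad u)

/-- `Q` satisfies the `ℓ^p`-Sobolev inequality. -/
def Sobolev (p : ℝ≥0∞) : Prop := ∃ S : ℝ, Q.SobolevWith p S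

/-- The `ℓ^p`-Sobolev constant: the smallest constant in the `ℓ^p`-Sobolev inequality. -/
noncomputable def sobolevConst (p : ℝ≥0∞) : ℝ := sInf {S : ℝ | Q.SobolevWith p S}

end DirichletForm

/-! Put α = 1 - 2/p. The Sobolev inequality enters only through two consequences, both due to `m(X)
< ∞`: compactness of the embedding of the form domain into ℓ², and an upper bound for the heat
trace.

Interpolating ℓ² between ℓ¹ and ℓᵖ turns the Sobolev inequality into a Nash inequality:
(‖u‖₂²)^(1+α) ≤ S Q(u) if ‖u‖₁ ≤ 1 (`SobolevWith.nash`). Let δ = 1_x / m(x), a unit vector of ℓ¹.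
Formally a(t) = ‖e^{-tL}δ‖² satisfies a' = -2 Q(e^{-tL}δ) ≤ -(2/S) a^(1+α), hence a(t) ≤
(S/(2αt))^(1/α). To avoid differentiating the semigroup, the argument runs along the implicit Euler
scheme (1 + (t/n)L)⁻ⁿ δ. A resolvent is a minimizer, so normal contractions give its ℓ^∞
contractivity at once, and duality gives ℓ¹. The discrete decay estimate is
`rpow_neg_ge_of_forall_succ_le`, and the limit n → ∞ is `tendsto_resolventOne_scale_pow`.

By Bessel's inequality, summing over an orthonormal family at time t/2 and integrating over X bounds
the trace of e^{-tL} by m(X) (S/(αt))^(1/α) (`SobolevWith.sum_re_inner_heatSemigroup_le`). So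
e^{-tL} is trace class, and only finitely many eigenvalues lie below any level. By compactness, the
whole spectrum consists of eigenvalues. Finally, with B the mean of the first k eigenvalues,
convexity of exp gives k e^{-tB} ≤ m(X) (S/(αt))^(1/α), and the best t yields B ≥ (k/m(X))^α / (eS).
The largest of the k eigenvalues is at least their mean. -/

/-! ### Functional calculus on eigenvectors -/

section FunctionalCalculus

variable {H : Type*} [NormedAddCommGroup H] [InnerProductSpace ℂ H] [CompleteSpace H]

/-- The continuous functional calculus acts on eigenvectors through the eigenvalue. -/
theorem cfc_apply_eigenvector {T : H →L[ℂ] H} (hT : IsSelfAdjoint T) {f : ℝ → ℝ}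
    (hf : Continuous f) {r : ℝ} {x : H} (hx : T x = (r : ℂ) • x) :
    cfc f T x = (f r : ℂ) • x := by
  rcases eq_or_ne x 0 with rfl | hne
  · simp
  have hr : r ∈ spectrum ℝ T := by
    rw [spectrum.mem_iff]
    rintro ⟨U, hU⟩
    apply hne
    have h1 : (U : H →L[ℂ] H) x = 0 := by
      rw [hU, sub_apply, hx, Algebra.algebraMap_eq_smul_one]
      simp
    have h2 : ((↑U⁻¹ : H →L[ℂ] H) * (U : H →L[ℂ] H)) x = 0 := by
      rw [mul_apply_eq_comp, h1, map_zero]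
    simpa using h2
  rw [cfc_apply f T hT hf.continuousOn]
  have key : ∀ g : C(spectrum ℝ T, ℝ), cfcHom hT g x = (g ⟨r, hr⟩ : ℂ) • x := by
    have : CompactSpace (spectrum ℝ T) := isCompact_iff_compactSpace.1
      (ContinuousFunctionalCalculus.isCompact_spectrum (R := ℝ) (p := IsSelfAdjoint) T)
    intro g
    induction g using ContinuousMap.induction_on_of_compact with
    | const c =>
      have : ContinuousMap.const (spectrum ℝ T) c = algebraMap ℝ C(spectrum ℝ T, ℝ) c := rfl
      rw [this, AlgHomClass.commutes, Algebra.algebraMap_eq_smul_one]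
      simp
    | id =>
      rw [cfcHom_id]
      simpa using hx
    | star_id =>
      rw [map_star, cfcHom_id, hT.star_eq]
      simpa using hx
    | add f g hf hg =>
      rw [map_add, add_apply, hf, hg, ContinuousMap.add_apply,
        Complex.ofReal_add, add_smul]
    | mul f g hf hg =>
      rw [map_mul, mul_apply_eq_comp, hg, map_smul, hf, ContinuousMap.mul_apply,
        Complex.ofReal_mul, smul_smul, mul_comm]
    | frequently f h =>
      have hc : IsClosed {g : C(spectrum ℝ T, ℝ) | cfcHom hT g x = (g ⟨r, hr⟩ : ℂ) • x} := by
        refine isClosed_eq ?_ ?_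
        · exact (ContinuousLinearMap.apply ℂ H x).continuous.comp (cfcHom_continuous hT)
        · exact (Complex.continuous_ofReal.comp
            (continuous_eval_const _)).smul continuous_const
      exact hc.mem_of_frequently_of_tendsto h Filter.tendsto_id
  rw [key]
  rfl

end FunctionalCalculus

/-! ### Eigenspaces of the generator, its resolvent and its heat semigroup -/

namespace ClosedForm

variable {H : Type*} [NormedAddCommGroup H] [InnerProductSpace ℂ H] (Q : ClosedForm H)

theorem mem_opEigenspace_iff {z : ℂ} {u : H} :
    u ∈ opEigenspace Q.generator z ↔ (u, z • u) ∈ Q.generator.graph := by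
  rw [LinearPMap.mem_graph_iff]
  constructor
  · rintro ⟨h, h'⟩
    exact ⟨⟨u, h⟩, rfl, h'⟩
  · rintro ⟨y, hy, hy'⟩
    obtain ⟨y, hyd⟩ := y
    obtain rfl : y = u := hy
    exact ⟨hyd, hy'⟩

/-- Eigenvalues of the generator are real and nonnegative. -/
theorem eigenvalue_real_nonneg {z : ℂ} {u : H} (hu : u ∈ opEigenspace Q.generator z)
    (hne : u ≠ 0) : 0 ≤ z.re ∧ z = (z.re : ℂ) := by
  rw [mem_opEigenspace_iff, graph_generator, mem_generatorGraph] at hu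
  obtain ⟨h, hv⟩ := hu
  have h1 := hv ⟨u, h⟩
  simp only [inner_smul_left, inner_self_eq_norm_sq_to_K] at h1
  have hpos : 0 < ‖u‖ ^ 2 := by positivity
  have h2 := Q.hermitian ⟨u, h⟩ ⟨u, h⟩
  have h3 := Q.nonneg ⟨u, h⟩
  rw [h1] at h2 h3
  have hre : 0 ≤ z.re * ‖u‖ ^ 2 := by
    have h4 : ((starRingEnd ℂ) z * (‖u‖ : ℂ) ^ 2).re = z.re * ‖u‖ ^ 2 := by
      rw [← Complex.ofReal_pow, Complex.re_mul_ofReal, Complex.conj_re]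
    rw [← h4]
    exact h3
  refine ⟨nonneg_of_mul_nonneg_left hre hpos, ?_⟩
  rw [map_mul, Complex.conj_conj] at h2
  have h5 : z = conj z := by
    refine mul_right_cancel₀ (b := ((‖u‖ : ℂ) ^ 2)) (by exact_mod_cast hpos.ne') ?_
    rw [map_pow, RCLike.conj_ofReal] at h2
    exact h2
  exact (Complex.conj_eq_iff_re.1 h5.symm).symm

theorem opEigenspace_eq_bot_of_neg {s : ℝ} (hs : s < 0) :
    opEigenspace Q.generator (s : ℂ) = ⊥ := by
  rw [Submodule.eq_bot_iff]
  intro u hu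
  by_contra hne
  have := (Q.eigenvalue_real_nonneg hu hne).1
  rw [Complex.ofReal_re] at this
  linarith

/-- Multiplying a closed form by a positive constant. -/
noncomputable def scale (s : ℝ) (hs : 0 < s) : ClosedForm H where
  domain := Q.domain
  form := (s : ℂ) • Q.form
  dense_domain := Q.dense_domain
  hermitian u v := by
    simp only [LinearMap.smul_apply, smul_eq_mul, map_mul, Complex.conj_ofReal, Q.hermitian]
  nonneg u := by
    simp only [LinearMap.smul_apply, smul_eq_mul, Complex.re_ofReal_mul]
    exact mul_nonneg hs.le (Q.nonneg u)
  closed u v hc hv := by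
    simp only [LinearMap.smul_apply, smul_eq_mul, Complex.re_ofReal_mul] at hc ⊢
    obtain ⟨h, hlim⟩ := Q.closed u v (fun ε hε => by
      obtain ⟨N, hN⟩ := hc (s * ε) (mul_pos hs hε)
      exact ⟨N, fun i hi j hj => lt_of_mul_lt_mul_left (hN i hi j hj) hs.le⟩) hv
    refine ⟨h, ?_⟩
    simpa using hlim.const_mul s

theorem mem_scale_generatorGraph {s : ℝ} (hs : 0 < s) {u g : H}
    (h : (u, g) ∈ Q.generatorGraph) : (u, (s : ℂ) • g) ∈ (Q.scale s hs).generatorGraph := by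
  rw [mem_generatorGraph] at h ⊢
  obtain ⟨hu, hv⟩ := h
  refine ⟨hu, fun v => ?_⟩
  have := hv v
  change (s : ℂ) • Q.form ⟨u, hu⟩ v = _
  rw [this, inner_smul_left, Complex.conj_ofReal, smul_eq_mul]

theorem norm_incl_le : ‖Q.incl‖ ≤ 1 := LinearMap.mkContinuous_norm_le _ zero_le_one _

variable [CompleteSpace H]

theorem resolventOne_apply_of_mem_opEigenspace {r : ℝ} (hr : 0 ≤ r) {u : H}
    (hu : u ∈ opEigenspace Q.generator (r : ℂ)) :
    Q.resolventOne u = (((1 + r)⁻¹ : ℝ) : ℂ) • u := by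
  have h1 : Q.resolventOne ((1 + r : ℂ) • u) = u := by
    rw [resolventOne_eq_iff, add_smul, one_smul, add_sub_cancel_left]
    exact Q.mem_opEigenspace_iff.1 hu
  have h0 : (1 + r : ℂ) ≠ 0 := by
    have : (1 + r : ℝ) ≠ 0 := by positivity
    exact_mod_cast this
  rw [map_smul] at h1
  rw [eq_comm, Complex.ofReal_inv, Complex.ofReal_add, Complex.ofReal_one, inv_smul_eq_iff₀ h0,
    h1]

/-- Division by 1 + z is avoided on purpose: the case z = -1 then says that the eigenspace is zero.
-/
theorem mem_opEigenspace_iff_resolventOne {z : ℂ} {u : H} :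
    u ∈ opEigenspace Q.generator z ↔ Q.resolventOne ((1 + z) • u) = u := by
  rw [resolventOne_eq_iff, add_smul, one_smul, add_sub_cancel_left, mem_opEigenspace_iff]

/-- The generator is single valued, so (0, f) in its graph forces f = 0. Hence 0 is not an
eigenvalue of the resolvent, and every eigenvector of the resolvent is one of the generator. -/
theorem resolventOne_injective : Function.Injective Q.resolventOne := by
  rw [injective_iff_map_eq_zero]
  intro f hf
  rw [resolventOne_eq_iff, LinearPMap.mem_graph_iff] at hf
  obtain ⟨y, hy, hy'⟩ := hf
  obtain rfl : y = 0 := Subtype.ext hy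
  rw [LinearPMap.map_zero, sub_zero] at hy'
  exact hy'.symm

theorem norm_resolventOne_apply_le (f : H) : ‖Q.resolventOne f‖ ≤ ‖f‖ := by
  have h : ‖Q.resolventOne‖ ≤ 1 := by
    refine (ContinuousLinearMap.opNorm_comp_le _ _).trans ?_
    rw [ContinuousLinearMap.adjoint.norm_map]
    exact mul_le_one₀ Q.norm_incl_le (norm_nonneg _) Q.norm_incl_le
  exact (Q.resolventOne.le_of_opNorm_le h f).trans (one_mul _).le

theorem inner_resolventOne_left (f g : H) :
    ⟪Q.resolventOne f, g⟫_ℂ = ⟪f, Q.resolventOne g⟫_ℂ := by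
  rw [← ContinuousLinearMap.adjoint_inner_right, Q.isSelfAdjoint_resolventOne.adjoint_eq]

theorem heatSemigroup_apply_of_mem_opEigenspace {t r : ℝ} (ht : 0 < t) {u : H}
    (hu : u ∈ opEigenspace Q.generator (r : ℂ)) :
    Q.heatSemigroup t u = (Real.exp (-t * r) : ℂ) • u := by
  rcases eq_or_ne u 0 with rfl | hne
  · simp
  have hr : 0 ≤ r := by simpa using (Q.eigenvalue_real_nonneg hu hne).1
  rw [heatSemigroup, cfc_apply_eigenvector Q.isSelfAdjoint_resolventOne
    (continuous_heatSymbol t ht) (Q.resolventOne_apply_of_mem_opEigenspace hr hu),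
    heatSymbol_one_add_inv _ _ hr]

theorem isSelfAdjoint_heatSemigroup (t : ℝ) : IsSelfAdjoint (Q.heatSemigroup t) :=
  cfc_predicate _ _

theorem heatSemigroup_nonneg (t : ℝ) : 0 ≤ Q.heatSemigroup t := by
  refine cfc_nonneg fun r _ => ?_
  rw [heatSymbol]
  split_ifs <;> positivity

theorem heatSemigroup_half_mul_self {t : ℝ} (ht : 0 < t) :
    Q.heatSemigroup (t / 2) * Q.heatSemigroup (t / 2) = Q.heatSemigroup t := by
  have hc := (continuous_heatSymbol (t / 2) (half_pos ht)).continuousOn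
    (s := spectrum ℝ Q.resolventOne)
  rw [heatSemigroup, heatSemigroup, ← cfc_mul _ _ _ hc hc]
  congr 1
  funext r
  simp only [heatSymbol]
  split_ifs
  · simp
  · rw [← Real.exp_add]
    congr 1
    ring

theorem re_inner_heatSemigroup_self {t : ℝ} (ht : 0 < t) (f : H) :
    (⟪f, Q.heatSemigroup t f⟫_ℂ).re = ‖Q.heatSemigroup (t / 2) f‖ ^ 2 := by
  rw [← Q.heatSemigroup_half_mul_self ht, mul_apply_eq_comp,
    ← ContinuousLinearMap.adjoint_inner_left, (Q.isSelfAdjoint_heatSemigroup _).adjoint_eq,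
    ← inner_self_eq_norm_sq (𝕜 := ℂ)]
  rfl

/-! ### Forms with compactly embedded domain -/

theorem isCompactOperator_resolventOne (hQ : IsCompactOperator Q.incl) :
    IsCompactOperator Q.resolventOne := hQ.comp_clm _

/-- The eigenvectors of the generator span a dense subspace. -/
theorem dense_iSup_opEigenspace (hQ : IsCompactOperator Q.incl) :
    Dense (↑(⨆ s : ℝ, opEigenspace Q.generator (s : ℂ)) : Set H) := by
  rw [Submodule.dense_iff_topologicalClosure_eq_top,
    Submodule.topologicalClosure_eq_top_iff, eq_bot_iff,
    ← ContinuousLinearMap.orthogonalComplement_iSup_eigenspaces_eq_bot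
      (Q.isCompactOperator_resolventOne hQ) Q.isSelfAdjoint_resolventOne.isSymmetric]
  refine Submodule.orthogonal_le (iSup_le fun μ u hu => ?_)
  rw [Module.End.mem_eigenspace_iff] at hu
  change Q.resolventOne u = μ • u at hu
  rcases eq_or_ne u 0 with rfl | hne
  · exact zero_mem _
  rcases eq_or_ne μ 0 with rfl | hμ
  · rw [zero_smul] at hu
    exact absurd (Q.resolventOne_injective (hu.trans (map_zero _).symm)) hne
  have h : u ∈ opEigenspace Q.generator (μ⁻¹ - 1) := by
    rw [mem_opEigenspace_iff_resolventOne, add_sub_cancel, map_smul, hu, smul_smul,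
      inv_mul_cancel₀ hμ, one_smul]
  rw [(Q.eigenvalue_real_nonneg h hne).2] at h
  exact Submodule.mem_iSup_of_mem (μ⁻¹ - 1).re h

/-- Every point of the spectrum of the generator is an eigenvalue. -/
theorem opEigenspace_ne_bot_of_mem_opSpectrum (hQ : IsCompactOperator Q.incl) {z : ℂ}
    (hz : z ∈ opSpectrum Q.generator) : opEigenspace Q.generator z ≠ ⊥ := by
  have hgraph : ∀ {u g : H}, Q.resolventOne (u + g) = u →
      ∃ h : u ∈ Q.generator.domain, Q.generator ⟨u, h⟩ = g := fun {u g} h => by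
    rw [resolventOne_eq_iff, add_sub_cancel_left, LinearPMap.mem_graph_iff] at h
    obtain ⟨⟨y, hyd⟩, hy, hy'⟩ := h
    obtain rfl : y = u := hy
    exact ⟨hyd, hy'⟩
  have hres : ∀ u : Q.generator.domain, Q.resolventOne (u + Q.generator u) = u := fun u => by
    rw [resolventOne_eq_iff, add_sub_cancel_left]
    exact LinearPMap.mem_graph _ _
  intro hbot
  apply hz
  rcases eq_or_ne (1 + z) 0 with h0 | h0
  · obtain rfl : z = -1 := by linear_combination h0
    refine ⟨Q.resolventOne, fun f => ?_, fun u => ?_⟩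
    · obtain ⟨h, h'⟩ := hgraph (u := Q.resolventOne f) (g := f - Q.resolventOne f) (by simp)
      exact ⟨h, by rw [h']; simp⟩
    · rw [neg_smul, one_smul, sub_neg_eq_add, add_comm, hres]
  · have hμ : (1 + z)⁻¹ ≠ 0 := inv_ne_zero h0
    -- Fredholm alternative for R = (1 + L)⁻¹ at (1 + z)⁻¹; an eigenvector of R there would be an
    -- eigenvector of L for z.
    rcases (Q.isCompactOperator_resolventOne hQ).hasEigenvalue_or_mem_resolventSet hμ with h | h
    · obtain ⟨v, hv, hne⟩ := h.exists_hasEigenvector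
      rw [Module.End.mem_eigenspace_iff] at hv
      change Q.resolventOne v = _ at hv
      refine absurd ?_ hne
      rw [← Submodule.mem_bot ℂ, ← hbot, mem_opEigenspace_iff_resolventOne, map_smul, hv,
        smul_smul, mul_inv_cancel₀ h0, one_smul]
    · rw [spectrum.mem_resolventSet_iff] at h
      obtain ⟨U, hU⟩ := h
      have hUT : ∀ x, (U : H →L[ℂ] H) x = (1 + z)⁻¹ • x - Q.resolventOne x := fun x => by
        rw [hU, sub_apply, Algebra.algebraMap_eq_smul_one]
        simp
      have hinv1 : ∀ x, (U : H →L[ℂ] H) ((↑U⁻¹ : H →L[ℂ] H) x) = x := fun x => by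
        rw [← mul_apply_eq_comp, Units.mul_inv, one_apply_eq_self]
      have hinv2 : ∀ x, (↑U⁻¹ : H →L[ℂ] H) ((U : H →L[ℂ] H) x) = x := fun x => by
        rw [← mul_apply_eq_comp, Units.inv_mul, one_apply_eq_self]
      -- From L - z = (1 - (1 + z)R)(1 + L) one gets (L - z)⁻¹ = (1 + z)⁻¹ ((1 + z)⁻¹ - R)⁻¹ R.
      refine ⟨(1 + z)⁻¹ • ((↑U⁻¹ : H →L[ℂ] H) * Q.resolventOne), fun f => ?_, fun u => ?_⟩
      · set w : H := (↑U⁻¹ : H →L[ℂ] H) (Q.resolventOne f) with hw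
        have h1 : (1 + z)⁻¹ • w - Q.resolventOne w = Q.resolventOne f := by
          rw [← hUT, hw, hinv1]
        change ∃ h : (1 + z)⁻¹ • w ∈ _, _
        obtain ⟨h, h'⟩ := hgraph (u := (1 + z)⁻¹ • w) (g := f + z • (1 + z)⁻¹ • w) (by
          have h2 : (1 + z)⁻¹ • w + (f + z • (1 + z)⁻¹ • w) = f + w := by
            have : w = (1 + z) • (1 + z)⁻¹ • w := by rw [smul_smul, mul_inv_cancel₀ h0, one_smul]
            conv_rhs => rw [this, add_smul, one_smul]
            abel
          rw [h2, map_add, ← h1, sub_add_cancel])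
        refine ⟨h, ?_⟩
        erw [h']
        exact add_sub_cancel_right _ _
      · change (1 + z)⁻¹ • (↑U⁻¹ : H →L[ℂ] H) (Q.resolventOne (Q.generator u - z • (u : H))) = u
        have h1 : Q.resolventOne (Q.generator u - z • (u : H)) =
            (U : H →L[ℂ] H) ((1 + z) • (u : H)) := by
          have h2 : Q.generator u - z • (u : H) = (u + Q.generator u) - (1 + z) • (u : H) := by
            rw [add_smul, one_smul]
            abel
          rw [h2, map_sub, hres, hUT, smul_smul, inv_mul_cancel₀ h0, one_smul]
        rw [h1, hinv2, smul_smul, inv_mul_cancel₀ h0, one_smul]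

end ClosedForm

/-! ### The exponential formula -/

namespace ClosedForm

variable {H : Type*} [NormedAddCommGroup H] [InnerProductSpace ℂ H] [CompleteSpace H]
  (Q : ClosedForm H)

theorem norm_resolventOne_pow_apply_le (n : ℕ) (f : H) : ‖(Q.resolventOne ^ n) f‖ ≤ ‖f‖ := by
  induction n with
  | zero => simp
  | succ n ih =>
    rw [pow_succ', mul_apply_eq_comp]
    exact (Q.norm_resolventOne_apply_le _).trans ih

/-- The exponential formula `(1 + (t / n) L)⁻ⁿ f → e^{-tL} f`. -/
theorem tendsto_resolventOne_scale_pow (hQ : IsCompactOperator Q.incl) {t : ℝ} (ht : 0 < t)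
    (f : H) :
    Filter.Tendsto (fun n : ℕ => ((Q.scale (t / (n + 1)) (by positivity)).resolventOne ^ (n + 1)) f)
      Filter.atTop (nhds (Q.heatSemigroup t f)) := by
  set A : ℕ → H →L[ℂ] H := fun n =>
    (Q.scale (t / (n + 1)) (by positivity)).resolventOne ^ (n + 1) with hA
  -- The vectors for which convergence holds form a subspace, closed because the powers are
  -- uniformly contractive. It contains the eigenvectors, where the claim is (1 + tr/N)⁻ᴺ → e^{-tr},
  -- and these span a dense subspace.
  let V : Submodule ℂ H :=
    { carrier := {f | Filter.Tendsto (fun n => A n f) Filter.atTop (nhds (Q.heatSemigroup t f))}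
      add_mem' := fun {a b} ha hb => by simpa using Filter.Tendsto.add ha hb
      zero_mem' := by simp
      smul_mem' := fun c a ha => by simpa using Filter.Tendsto.const_smul ha c }
  have hV : (⨆ s : ℝ, opEigenspace Q.generator (s : ℂ)) ≤ V := by
    refine iSup_le fun r u hu => ?_
    change Filter.Tendsto (fun n => A n u) Filter.atTop (nhds (Q.heatSemigroup t u))
    rcases eq_or_ne u 0 with rfl | hne
    · simp
    have hr : 0 ≤ r := by simpa using (Q.eigenvalue_real_nonneg hu hne).1
    have h1 : ∀ n : ℕ, A n u = ((((1 + (t * r) / ((n + 1 : ℕ) : ℝ)) ^ (n + 1))⁻¹ : ℝ) : ℂ) • u :=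
        fun n => by
      have hs : (0 : ℝ) < t / (n + 1) := by positivity
      have h2 : u ∈ opEigenspace (Q.scale (t / (n + 1)) hs).generator
          ((t / (n + 1) * r : ℝ) : ℂ) := by
        rw [mem_opEigenspace_iff, graph_generator] at hu ⊢
        rw [Complex.ofReal_mul, mul_smul]
        exact Q.mem_scale_generatorGraph hs hu
      have h3 := (Q.scale (t / (n + 1)) hs).resolventOne_apply_of_mem_opEigenspace
        (by positivity) h2
      have h4 : ∀ k : ℕ, ((Q.scale (t / (n + 1)) hs).resolventOne ^ k) u =
          ((((1 + t / (n + 1) * r)⁻¹) ^ k : ℝ) : ℂ) • u := fun k => by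
        induction k with
        | zero => simp
        | succ k ih =>
          rw [pow_succ', mul_apply_eq_comp, ih, map_smul, h3, smul_smul, pow_succ,
            Complex.ofReal_mul]
      change ((Q.scale (t / (n + 1)) hs).resolventOne ^ (n + 1)) u = _
      rw [h4, inv_pow]
      congr 5
      push_cast
      ring
    rw [Q.heatSemigroup_apply_of_mem_opEigenspace ht hu]
    simp_rw [h1]
    have h5 := ((Real.tendsto_one_add_div_pow_exp (t * r)).comp
      (Filter.tendsto_add_atTop_nat 1)).inv₀ (Real.exp_pos _).ne'
    rw [← Real.exp_neg, ← neg_mul] at h5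
    exact ((Complex.continuous_ofReal.tendsto _).comp h5).smul_const u
  have hclosed : IsClosed (V : Set H) := by
    refine Equicontinuous.isClosed_setOfPred_tendsto (F := fun n => A n) ?_
      (Q.heatSemigroup t).continuous
    refine (LipschitzWith.uniformEquicontinuous _ 1 fun n => ?_).equicontinuous
    refine LipschitzWith.of_dist_le_mul fun x y => ?_
    rw [dist_eq_norm, dist_eq_norm, ← map_sub, NNReal.coe_one, one_mul]
    exact norm_resolventOne_pow_apply_le _ _ _
  exact hclosed.closure_subset_iff.2 hV (Q.dense_iSup_opEigenspace hQ f)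

end ClosedForm

/-! ### The resolvent as a minimizer -/

namespace ClosedForm

variable {H : Type*} [NormedAddCommGroup H] [InnerProductSpace ℂ H] [CompleteSpace H]
  (Q : ClosedForm H)

theorem resolventOne_mem_domain (f : H) : Q.resolventOne f ∈ Q.domain :=
  (Q.toDomain (Q.incl.adjoint f)).2

theorem form_resolventOne (f : H) (v : Q.domain) :
    Q.form ⟨Q.resolventOne f, Q.resolventOne_mem_domain f⟩ v =
      ⟪f - Q.resolventOne f, (v : H)⟫_ℂ := by
  have h := (Q.resolventOne_eq_iff f _).1 rfl
  rw [graph_generator, mem_generatorGraph] at h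
  exact h.2 v

/-- `(1 + L)⁻¹ f` is the only minimizer of `w ↦ Q(w) + ‖w - f‖²`. -/
theorem eq_resolventOne_of_le (f : H) (w : Q.domain)
    (hq : Q.quad w ≤ Q.quad ⟨Q.resolventOne f, Q.resolventOne_mem_domain f⟩)
    (hn : ‖(w : H) - f‖ ≤ ‖Q.resolventOne f - f‖) : (w : H) = Q.resolventOne f := by
  set u : Q.domain := ⟨Q.resolventOne f, Q.resolventOne_mem_domain f⟩ with hu
  have hform : ∀ v : Q.domain, Q.form u v = ⟪f - (u : H), (v : H)⟫_ℂ := Q.form_resolventOne f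
  obtain ⟨d, rfl⟩ : ∃ d, w = u + d := ⟨w - u, by abel⟩
  change ‖((u : H) + d) - f‖ ≤ ‖(u : H) - f‖ at hn
  have h1 : Q.quad (u + d) = Q.quad u + 2 * (⟪f - (u : H), (d : H)⟫_ℂ).re + Q.quad d := by
    have h2 : Q.form d u = conj (Q.form u d) := (Q.hermitian d u).symm
    simp only [quad, map_add, LinearMap.add_apply, Complex.add_re, h2, Complex.conj_re, hform]
    ring
  have h3 : ‖((u : H) + d) - f‖ ^ 2 =
      ‖(u : H) - f‖ ^ 2 - 2 * (⟪f - (u : H), (d : H)⟫_ℂ).re + ‖(d : H)‖ ^ 2 := by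
    have h4 : ((u : H) + d) - f = ((u : H) - f) + d := by abel
    have h5 : (⟪(u : H) - f, (d : H)⟫_ℂ).re = - (⟪f - (u : H), (d : H)⟫_ℂ).re := by
      rw [← neg_sub f, inner_neg_left, Complex.neg_re]
    have h6 := norm_add_sq (𝕜 := ℂ) ((u : H) - f) (d : H)
    rw [h4, h6]
    change _ + 2 * (⟪(u : H) - f, (d : H)⟫_ℂ).re + _ = _
    rw [h5]
    ring
  have h7 : ‖((u : H) + d) - f‖ ^ 2 ≤ ‖(u : H) - f‖ ^ 2 := by gcongr
  have h8 : 0 ≤ Q.quad d := Q.nonneg d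
  have h9 : ‖(d : H)‖ ^ 2 = 0 := le_antisymm (by linarith) (sq_nonneg _)
  have h10 : (d : H) = 0 := by simpa using h9
  change (u : H) + d = u
  rw [h10, add_zero]

/-- Expand ‖f‖² = ‖(f - u) + u‖² for u = (1 + L)⁻¹ f: the real part of ⟨f - u, u⟩ is Q(u). This is
the energy inequality for one implicit Euler step, the discrete form of (‖u‖²)' = -2 Q(u). -/
theorem norm_resolventOne_sq_add_le (f : H) :
    ‖Q.resolventOne f‖ ^ 2 + 2 * Q.quad ⟨Q.resolventOne f, Q.resolventOne_mem_domain f⟩ ≤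
      ‖f‖ ^ 2 := by
  have h := Q.form_resolventOne f ⟨Q.resolventOne f, Q.resolventOne_mem_domain f⟩
  have h1 := norm_add_sq (𝕜 := ℂ) (f - Q.resolventOne f) (Q.resolventOne f)
  rw [sub_add_cancel, ← h] at h1
  change _ = _ + 2 * Q.quad _ + _ at h1
  rw [h1]
  linarith [sq_nonneg ‖f - Q.resolventOne f‖]

end ClosedForm

/-! ### Contractivity of the resolvent in the supremum norm and in ℓ¹ -/

section DiscreteMeasure

variable {X : Type*} [MeasurableSpace X] [DiscreteMeasurableSpace X]

theorem discreteMeasure_singleton (m : X → ℝ) (x : X) :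
    discreteMeasure m {x} = ENNReal.ofReal (m x) := by
  rw [discreteMeasure, MeasureTheory.Measure.sum_apply _ (MeasurableSet.of_discrete)]
  rw [tsum_eq_single x]
  · simp
  · intro y hy
    simp [hy]

theorem ae_discreteMeasure_iff {m : X → ℝ} (hm : ∀ x, 0 < m x) {P : X → Prop} :
    (∀ᵐ x ∂discreteMeasure m, P x) ↔ ∀ x, P x := by
  refine ⟨fun h x => ?_, fun h => Filter.Eventually.of_forall h⟩
  by_contra hx
  have h1 : discreteMeasure m {x} ≤ 0 := by
    rw [← MeasureTheory.ae_iff.1 h]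
    exact MeasureTheory.measure_mono (by simpa using hx)
  rw [discreteMeasure_singleton] at h1
  have := ENNReal.ofReal_pos.2 (hm x)
  exact absurd h1 (not_le.2 this)

end DiscreteMeasure

/-- The projection of the complex plane onto the half-plane `re z ≤ 1`. -/
noncomputable def halfPlaneProj (z : ℂ) : ℂ := ⟨min z.re 1, z.im⟩

theorem lipschitzWith_halfPlaneProj : LipschitzWith 1 halfPlaneProj := by
  refine LipschitzWith.of_dist_le_mul fun z w => ?_
  rw [NNReal.coe_one, one_mul, Complex.dist_eq_re_im, Complex.dist_eq_re_im]
  refine Real.sqrt_le_sqrt (add_le_add_left ?_ _)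
  rw [sq_le_sq]
  exact (abs_min_sub_min_le_max _ _ _ _).trans (by simp)

theorem halfPlaneProj_zero : halfPlaneProj 0 = 0 := by
  apply Complex.ext <;> simp [halfPlaneProj]

theorem halfPlaneProj_eq_self {z : ℂ} (hz : z.re ≤ 1) : halfPlaneProj z = z := by
  apply Complex.ext <;> simp [halfPlaneProj, hz]

namespace DirichletForm

variable {X : Type*} [MeasurableSpace X] {m : X → ℝ} (Q : DirichletForm m)

/-- Multiplying a Dirichlet form by a positive constant. -/
noncomputable def scale (s : ℝ) (hs : 0 < s) : DirichletForm m where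
  toClosedForm := Q.toClosedForm.scale s hs
  contraction C hC hC0 u := by
    obtain ⟨h, h'⟩ := Q.contraction C hC hC0 u
    refine ⟨h, ?_⟩
    have hre : ∀ v w : Q.domain, (((Q.toClosedForm.scale s hs).form v w)).re =
        s * (Q.form v w).re := fun v w => Complex.re_ofReal_mul _ _
    exact (hre _ _).trans_le ((mul_le_mul_of_nonneg_left h' hs.le).trans_eq (hre _ _).symm)

/-- The projection onto the half-plane fixes f. Applied to the minimizer of w ↦ Q(w) + ‖w - f‖² it
increases neither term, so by uniqueness the minimizer is fixed too. -/
theorem re_resolventOne_le_one {f : L2 m} (hf : ∀ᵐ x ∂discreteMeasure m, (f x).re ≤ 1) :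
    ∀ᵐ x ∂discreteMeasure m, (Q.resolventOne f x).re ≤ 1 := by
  set u : Q.domain := ⟨Q.resolventOne f, Q.resolventOne_mem_domain f⟩ with hu
  obtain ⟨h, h'⟩ := Q.contraction _ lipschitzWith_halfPlaneProj halfPlaneProj_zero u
  have hCf : lipschitzWith_halfPlaneProj.compLp halfPlaneProj_zero f = f := by
    apply MeasureTheory.Lp.ext
    filter_upwards [lipschitzWith_halfPlaneProj.coeFn_compLp halfPlaneProj_zero f, hf]
      with x h1 h2
    rw [h1, Function.comp_apply, halfPlaneProj_eq_self h2]
  have key := Q.eq_resolventOne_of_le f ⟨_, h⟩ h' (by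
    conv_lhs => rw [← hCf]
    have := lipschitzWith_halfPlaneProj.norm_compLp_sub_le halfPlaneProj_zero (u : L2 m) f
    rwa [NNReal.coe_one, one_mul] at this)
  filter_upwards [lipschitzWith_halfPlaneProj.coeFn_compLp halfPlaneProj_zero (u : L2 m)]
    with x hx
  rw [← key, hx]
  exact min_le_right _ _

theorem integrable_coeFn [MeasureTheory.IsFiniteMeasure (discreteMeasure m)] (f : L2 m) :
    MeasureTheory.Integrable f (discreteMeasure m) :=
  (MeasureTheory.Lp.memLp f).integrable one_le_two

variable [DiscreteMeasurableSpace X]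

/-- The resolvent is a contraction for the supremum norm. -/
theorem norm_resolventOne_apply_le_one (hm : ∀ x, 0 < m x) {f : L2 m} (hf : ∀ x, ‖f x‖ ≤ 1)
    (x : X) : ‖Q.resolventOne f x‖ ≤ 1 := by
  set z := Q.resolventOne f x with hz
  rcases eq_or_ne z 0 with h0 | h0
  · simp [h0]
  -- Rotating f by ω makes the value at x equal to ‖z‖, so the bound on the real part bounds the
  -- modulus.
  set ω : ℂ := conj z / ‖z‖ with hω
  have hz' : (‖z‖ : ℂ) ≠ 0 := by simpa using h0
  have hωn : ‖ω‖ = 1 := by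
    rw [hω, norm_div, RCLike.norm_conj, Complex.norm_real, norm_norm,
      div_self (norm_ne_zero_iff.2 h0)]
  have h1 := (ae_discreteMeasure_iff hm).1 (Q.re_resolventOne_le_one (f := ω • f) (by
    filter_upwards [MeasureTheory.Lp.coeFn_smul ω f] with y hy
    rw [hy, Pi.smul_apply, smul_eq_mul]
    refine (Complex.re_le_norm _).trans ?_
    rw [norm_mul, hωn, one_mul]
    exact hf y)) x
  rw [map_smul, (ae_discreteMeasure_iff hm).1 (MeasureTheory.Lp.coeFn_smul ω _) x, Pi.smul_apply,
    ← hz, smul_eq_mul, hω, div_mul_eq_mul_div, mul_comm, Complex.mul_conj, Complex.normSq_eq_norm_sq,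
    Complex.ofReal_pow, sq, mul_div_assoc, div_self hz', mul_one, Complex.ofReal_re] at h1
  exact h1

/-- The resolvent is a contraction for the `ℓ¹` norm. -/
theorem integral_norm_resolventOne_le (hm : ∀ x, 0 < m x)
    [MeasureTheory.IsFiniteMeasure (discreteMeasure m)] (g : L2 m) :
    ∫ x, ‖Q.resolventOne g x‖ ∂discreteMeasure m ≤ ∫ x, ‖g x‖ ∂discreteMeasure m := by
  set u := Q.resolventOne g with hu
  -- Duality: w is the phase of u (and 0 where u = 0), so ⟨w, u⟩ = ‖u‖₁. Moving the resolvent onto w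
  -- costs nothing by the supremum bound.
  let w : X → ℂ := fun x => (‖u x‖ : ℂ)⁻¹ * u x
  have hw : ∀ x, ‖w x‖ ≤ 1 := fun x => by
    simp only [w]
    rw [norm_mul, norm_inv, Complex.norm_real, norm_norm]
    exact inv_mul_le_one
  have hwm : MeasureTheory.MemLp w 2 (discreteMeasure m) :=
    MeasureTheory.MemLp.of_bound (Measurable.of_discrete).aestronglyMeasurable 1
      (Filter.Eventually.of_forall hw)
  set f : L2 m := hwm.toLp w with hf
  have hfw : ∀ x, f x = w x := (ae_discreteMeasure_iff hm).1 hwm.coeFn_toLp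
  have h1 : ⟪f, u⟫_ℂ = ((∫ x, ‖u x‖ ∂discreteMeasure m : ℝ) : ℂ) := by
    rw [MeasureTheory.L2.inner_def, ← integral_complex_ofReal]
    congr 1
    funext x
    rw [hfw, RCLike.inner_apply']
    rcases eq_or_ne (u x) 0 with h0 | h0
    · simp [w, h0]
    have hz' : (‖u x‖ : ℂ) ≠ 0 := by simpa using h0
    simp only [w, map_mul, map_inv₀, Complex.conj_ofReal]
    rw [mul_assoc, mul_comm (conj (u x)), Complex.mul_conj, Complex.normSq_eq_norm_sq]
    push_cast
    field_simp
  have h2 : ‖⟪f, u⟫_ℂ‖ ≤ ∫ x, ‖g x‖ ∂discreteMeasure m := by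
    rw [hu, ← ClosedForm.inner_resolventOne_left, MeasureTheory.L2.inner_def]
    refine MeasureTheory.norm_integral_le_of_norm_le (integrable_coeFn g).norm
      (Filter.Eventually.of_forall fun x => ?_)
    refine (norm_inner_le_norm _ _).trans (mul_le_of_le_one_left (norm_nonneg _) ?_)
    exact Q.norm_resolventOne_apply_le_one hm (fun x => by rw [hfw]; exact hw x) x
  rw [h1, Complex.norm_real] at h2
  exact (le_abs_self _).trans h2

end DirichletForm

/-! ### Point masses and truncation to finite sets -/

section PointMass

variable {X : Type*} [MeasurableSpace X] [DiscreteMeasurableSpace X] (m : X → ℝ)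

theorem discreteMeasure_singleton_ne_top (x : X) : discreteMeasure m {x} ≠ ∞ := by
  rw [discreteMeasure_singleton]
  exact ENNReal.ofReal_ne_top

/-- The function `1_x / m x`, which represents the evaluation at `x` on `ℓ²(X, m)`. -/
noncomputable def pointMass (x : X) : L2 m :=
  MeasureTheory.indicatorConstLp 2 (MeasurableSet.of_discrete (s := {x}))
    (discreteMeasure_singleton_ne_top m x) ((m x : ℂ)⁻¹)

variable {m} (hm : ∀ x, 0 < m x)
include hm

theorem inner_pointMass (x : X) (u : L2 m) : ⟪pointMass m x, u⟫_ℂ = u x := by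
  have h0 : (m x : ℂ) ≠ 0 := by exact_mod_cast (hm x).ne'
  rw [pointMass, MeasureTheory.L2.inner_indicatorConstLp_eq_inner_setIntegral,
    MeasureTheory.integral_singleton, MeasureTheory.measureReal_def, discreteMeasure_singleton,
    ENNReal.toReal_ofReal (hm x).le, RCLike.inner_apply', map_inv₀, Complex.conj_ofReal,
    Complex.real_smul, inv_mul_cancel_left₀ h0]

theorem pointMass_apply (x y : X) : pointMass m x y = Set.indicator {x} (fun _ => (m x : ℂ)⁻¹) y :=
  (ae_discreteMeasure_iff hm).1 MeasureTheory.indicatorConstLp_coeFn y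

theorem integral_norm_pointMass (x : X) :
    ∫ y, ‖pointMass m x y‖ ∂discreteMeasure m = 1 := by
  have h : ∀ y, ‖pointMass m x y‖ = Set.indicator {x} (fun _ => (m x)⁻¹) y := fun y => by
    rw [pointMass_apply hm]
    by_cases hy : y ∈ ({x} : Set X)
    · simp only [Set.indicator_of_mem hy]
      rw [norm_inv, Complex.norm_real, Real.norm_of_nonneg (hm x).le]
    · simp [Set.indicator_of_notMem hy]
  simp_rw [h]
  rw [MeasureTheory.integral_indicator MeasurableSet.of_discrete,
    MeasureTheory.integral_singleton, MeasureTheory.measureReal_def, discreteMeasure_singleton,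
    ENNReal.toReal_ofReal (hm x).le, smul_eq_mul, mul_inv_cancel₀ (hm x).ne']

theorem pointMass_ne_zero (x : X) : pointMass m x ≠ 0 := by
  intro h
  have h1 := pointMass_apply hm x x
  rw [h, (ae_discreteMeasure_iff hm).1 (MeasureTheory.Lp.coeFn_zero _ _ _) x] at h1
  simp only [Set.mem_singleton_iff, Set.indicator_of_mem] at h1
  have h0 : (m x : ℂ)⁻¹ ≠ 0 := inv_ne_zero (by exact_mod_cast (hm x).ne')
  exact h0 h1.symm

omit hm in
variable (m) in
/-- The restriction of functions to a finite set. -/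
noncomputable def finsetTruncation (F : Finset X) : L2 m →L[ℂ] L2 m :=
  ∑ x ∈ F, (innerSL ℂ (pointMass m x)).smulRight ((m x : ℂ) • pointMass m x)

theorem finsetTruncation_apply (F : Finset X) (u : L2 m) (y : X) :
    finsetTruncation m F u y = Set.indicator (F : Set X) u y := by
  classical
  rw [← inner_pointMass hm, finsetTruncation, sum_apply, inner_sum]
  have h : ∀ x ∈ F, ⟪pointMass m y, (innerSL ℂ (pointMass m x)).smulRight
      ((m x : ℂ) • pointMass m x) u⟫_ℂ = if y = x then u x else 0 := fun x _ => by
    rw [ContinuousLinearMap.smulRight_apply, innerSL_apply_apply, inner_smul_right, inner_smul_right,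
      inner_pointMass hm, inner_pointMass hm, pointMass_apply hm]
    by_cases hxy : y = x
    · have h0 : (m x : ℂ) ≠ 0 := by exact_mod_cast (hm x).ne'
      simp [hxy, h0]
    · simp [hxy]
  rw [Finset.sum_congr rfl h, Finset.sum_ite_eq]
  simp [Set.indicator_apply]

omit hm in
theorem isCompactOperator_finsetTruncation (F : Finset X) :
    IsCompactOperator (finsetTruncation m F) := by
  change finsetTruncation m F ∈ compactOperator (RingHom.id ℂ) (L2 m) (L2 m)
  refine Submodule.sum_mem _ fun x _ => ?_
  have h : IsCompactOperator (innerSL ℂ (pointMass m x)) :=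
    isCompactOperator_of_locallyCompactSpace_dom (innerSL ℂ (pointMass m x) : L2 m →L[ℂ] ℂ)
  exact h.clm_comp (ContinuousLinearMap.toSpanSingleton ℂ ((m x : ℂ) • pointMass m x))

/-- Hölder's inequality on the complement of F. The last factor is small for large F since the total
mass is finite. -/
theorem norm_sub_finsetTruncation_le [MeasureTheory.IsFiniteMeasure (discreteMeasure m)]
    (F : Finset X) {p : ℝ≥0∞} (hp : 2 ≤ p) (u : L2 m) :
    ENNReal.ofReal ‖u - finsetTruncation m F u‖ ≤
      MeasureTheory.eLpNorm u p (discreteMeasure m) *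
        discreteMeasure m (F : Set X)ᶜ ^ (1 / 2 - 1 / p.toReal) := by
  have h : ∀ y, (u - finsetTruncation m F u : L2 m) y = Set.indicator (F : Set X)ᶜ u y :=
      fun y => by
    rw [(ae_discreteMeasure_iff hm).1 (MeasureTheory.Lp.coeFn_sub _ _) y, Pi.sub_apply,
      finsetTruncation_apply hm, Set.indicator_compl, Pi.sub_apply]
  rw [ofReal_norm, MeasureTheory.Lp.enorm_def, funext h,
    MeasureTheory.eLpNorm_indicator_eq_eLpNorm_restrict MeasurableSet.of_discrete]
  refine (MeasureTheory.eLpNorm_le_eLpNorm_mul_rpow_measure_univ hp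
    (Measurable.of_discrete).aestronglyMeasurable).trans ?_
  rw [MeasureTheory.Measure.restrict_apply_univ, ENNReal.toReal_ofNat]
  gcongr
  exact MeasureTheory.Measure.restrict_le_self

end PointMass

/-! ### Interpolation, compactness and the Nash inequality -/

section Interpolation

variable {X : Type*} [MeasurableSpace X] {μ : MeasureTheory.Measure X}

/-- Interpolation of the `L²` norm between `L¹` and `Lᵖ`. -/
theorem lintegral_enorm_sq_rpow_le {f : X → ℂ} (hf : MeasureTheory.AEStronglyMeasurable f μ)
    {p : ℝ≥0∞} (hp : 2 < p) (h1 : ∫⁻ x, ‖f x‖ₑ ∂μ ≤ 1) :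
    (∫⁻ x, ‖f x‖ₑ ^ 2 ∂μ) ^ (1 + (1 - 2 / p).toReal) ≤ MeasureTheory.eLpNorm f p μ ^ 2 := by
  rcases eq_or_ne p ∞ with rfl | hpt
  · have h2 : ∫⁻ x, ‖f x‖ₑ ^ 2 ∂μ ≤ MeasureTheory.eLpNorm f ∞ μ := by
      calc ∫⁻ x, ‖f x‖ₑ ^ 2 ∂μ ≤ ∫⁻ x, MeasureTheory.eLpNorm f ∞ μ * ‖f x‖ₑ ∂μ := by
            refine MeasureTheory.lintegral_mono_ae ?_
            filter_upwards [MeasureTheory.enorm_ae_le_eLpNormEssSup f μ] with x hx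
            rw [sq, MeasureTheory.eLpNorm_exponent_top]
            gcongr
        _ = MeasureTheory.eLpNorm f ∞ μ * ∫⁻ x, ‖f x‖ₑ ∂μ :=
            MeasureTheory.lintegral_const_mul'' _ hf.enorm
        _ ≤ _ := mul_le_of_le_one_right' h1
    have h3 : (1 + (1 - 2 / (∞ : ℝ≥0∞)).toReal) = ((2 : ℕ) : ℝ) := by norm_num
    rw [h3, ENNReal.rpow_natCast]
    gcongr
  · have hq : 2 < p.toReal := by
      rw [← ENNReal.toReal_ofNat 2]
      exact (ENNReal.toReal_lt_toReal (by simp) hpt).2 hp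
    set q := p.toReal with hqdef
    have hα : (1 - 2 / p).toReal = 1 - 2 / q := by
      rw [ENNReal.toReal_sub_of_le (ENNReal.div_le_of_le_mul (by simpa using hp.le)) (by simp),
        ENNReal.toReal_div]
      simp [hqdef]
    have hq1 : 0 < q - 1 := by linarith
    -- Hölder with weights (q - 2)/(q - 1) and 1/(q - 1) on |f| and |f|^q; they sum to 1, and (q -
    -- 2)/(q - 1) + q/(q - 1) = 2.
    have h2 : ∫⁻ x, ‖f x‖ₑ ^ 2 ∂μ ≤ (∫⁻ x, ‖f x‖ₑ ^ q ∂μ) ^ (1 / (q - 1)) := by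
      calc ∫⁻ x, ‖f x‖ₑ ^ 2 ∂μ
          = ∫⁻ x, ‖f x‖ₑ ^ ((q - 2) / (q - 1)) * (‖f x‖ₑ ^ q) ^ (1 / (q - 1)) ∂μ := by
            congr 1
            funext x
            rw [← ENNReal.rpow_mul, ← ENNReal.rpow_add_of_nonneg _ _ (by
              apply div_nonneg <;> linarith) (by positivity)]
            rw [← ENNReal.rpow_natCast]
            congr 1
            push_cast
            field_simp
            ring
        _ ≤ (∫⁻ x, ‖f x‖ₑ ∂μ) ^ ((q - 2) / (q - 1)) * (∫⁻ x, ‖f x‖ₑ ^ q ∂μ) ^ (1 / (q - 1)) :=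
            ENNReal.lintegral_mul_norm_pow_le hf.enorm (hf.enorm.pow_const _)
              (by apply div_nonneg <;> linarith) (by positivity) (by field_simp; ring)
        _ ≤ _ := mul_le_of_le_one_left' (ENNReal.rpow_le_one h1 (by
              apply div_nonneg <;> linarith))
    rw [hα, MeasureTheory.eLpNorm_eq_lintegral_rpow_enorm_toReal (by
      rintro rfl; simp at hp) hpt, ← hqdef]
    have h2q : 0 ≤ 1 + (1 - 2 / q) := by
      have : 2 / q < 1 := by rw [div_lt_one] <;> linarith
      linarith
    refine (ENNReal.rpow_le_rpow h2 h2q).trans_eq ?_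
    rw [← ENNReal.rpow_mul, ← ENNReal.rpow_natCast, ← ENNReal.rpow_mul]
    congr 1
    push_cast
    field_simp
    ring

end Interpolation

namespace DirichletForm

variable {X : Type*} [MeasurableSpace X] {m : X → ℝ} {Q : DirichletForm m}

/-- Truncations to finite sets have finite rank and, by the Sobolev inequality, converge to the
inclusion in operator norm. -/
theorem SobolevWith.isCompactOperator_incl [Countable X] [DiscreteMeasurableSpace X]
    (hm : ∀ x, 0 < m x)
    [MeasureTheory.IsFiniteMeasure (discreteMeasure m)] {p : ℝ≥0∞} (hp : 2 < p) {S : ℝ}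
    (hS : Q.SobolevWith p S) : IsCompactOperator Q.incl := by
  -- For p = ∞ the conventions `∞.toReal = 0` and 1/0 = 0 give the correct value 1/2.
  set e : ℝ := 1 / 2 - 1 / p.toReal with he
  have hepos : 0 < e := by
    rcases eq_or_ne p ∞ with rfl | hpt
    · norm_num [he]
    · have hq : 2 < p.toReal := by
        rw [← ENNReal.toReal_ofNat 2]
        exact (ENNReal.toReal_lt_toReal (by simp) hpt).2 hp
      rw [he, sub_pos]
      exact one_div_lt_one_div_of_lt two_pos hq
  have hbound : ∀ F : Finset X, ‖(finsetTruncation m F).comp Q.incl - Q.incl‖ ≤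
      Real.sqrt S * (discreteMeasure m (F : Set X)ᶜ ^ e).toReal := fun F => by
    refine ContinuousLinearMap.opNorm_le_bound _ (by positivity) fun u => ?_
    have hfin : discreteMeasure m (F : Set X)ᶜ ^ e ≠ ∞ :=
      ENNReal.rpow_ne_top_of_nonneg hepos.le (MeasureTheory.measure_ne_top _ _)
    have h1 := norm_sub_finsetTruncation_le hm F hp.le (Q.toDomain u : L2 m)
    rw [← he] at h1
    have h2 : MeasureTheory.eLpNorm (Q.toDomain u : L2 m) p (discreteMeasure m) ≤
        ENNReal.ofReal (Real.sqrt S * ‖u‖) := by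
      rw [← ENNReal.pow_le_pow_left_iff two_ne_zero, ← ENNReal.ofReal_pow (by positivity), mul_pow,
        Real.sq_sqrt hS.1]
      refine (hS.2 _).trans (ENNReal.ofReal_le_ofReal (mul_le_mul_of_nonneg_left ?_ hS.1))
      rw [ClosedForm.formDomain_norm_sq]
      exact le_add_of_nonneg_right (sq_nonneg _)
    have h3 : ENNReal.ofReal ‖(Q.toDomain u : L2 m) - finsetTruncation m F (Q.toDomain u : L2 m)‖ ≤
        ENNReal.ofReal (Real.sqrt S * (discreteMeasure m (F : Set X)ᶜ ^ e).toReal * ‖u‖) := by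
      refine (h1.trans (mul_le_mul_left h2 _)).trans_eq ?_
      rw [mul_right_comm, ENNReal.ofReal_mul (p := √S * ‖u‖) (by positivity),
        ENNReal.ofReal_toReal hfin]
    rw [norm_sub_rev] at h3
    exact (ENNReal.ofReal_le_ofReal_iff (by positivity)).1 h3
  have hmeas : Filter.Tendsto (fun F : Finset X => discreteMeasure m (F : Set X)ᶜ)
      Filter.atTop (nhds 0) := by
    have h := MeasureTheory.tendsto_measure_iInter_atTop (μ := discreteMeasure m)
      (s := fun F : Finset X => (F : Set X)ᶜ)
      (fun _ => MeasurableSet.of_discrete.nullMeasurableSet)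
      (fun F G hFG => Set.compl_subset_compl.2 (by exact_mod_cast hFG))
      ⟨∅, MeasureTheory.measure_ne_top _ _⟩
    have hempty : ⋂ F : Finset X, (F : Set X)ᶜ = ∅ := by
      rw [Set.eq_empty_iff_forall_notMem]
      intro x hx
      exact Set.mem_iInter.1 hx {x} (by simp)
    rwa [hempty, MeasureTheory.measure_empty] at h
  have hlim : Filter.Tendsto (fun F : Finset X => (finsetTruncation m F).comp Q.incl)
      Filter.atTop (nhds Q.incl) := by
    refine (tendsto_iff_norm_sub_tendsto_zero (E := Q.FormDomain →L[ℂ] L2 m)).2 ?_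
    refine squeeze_zero (fun F => norm_nonneg ((finsetTruncation m F).comp Q.incl - Q.incl)) hbound ?_
    have h1 := (ENNReal.continuous_rpow_const (y := e)).tendsto 0 |>.comp hmeas
    rw [ENNReal.zero_rpow_of_pos hepos] at h1
    have h2 := (ENNReal.tendsto_toReal ENNReal.zero_ne_top).comp h1
    simpa using h2.const_mul (Real.sqrt S)
  exact isCompactOperator_of_tendsto hlim (Filter.Eventually.of_forall fun F =>
    (isCompactOperator_finsetTruncation F).comp_clm Q.incl)

/-- The Nash inequality that follows from the Sobolev inequality by interpolation. -/
theorem SobolevWith.nash [MeasureTheory.IsFiniteMeasure (discreteMeasure m)] {p : ℝ≥0∞}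
    (hp : 2 < p) {S : ℝ} (hS : Q.SobolevWith p S) (u : Q.domain)
    (h1 : ∫ x, ‖(u : L2 m) x‖ ∂discreteMeasure m ≤ 1) :
    (‖(u : L2 m)‖ ^ 2) ^ (1 + (1 - 2 / p).toReal) ≤ S * Q.quad u := by
  have h2 : ∫⁻ x, ‖(u : L2 m) x‖ₑ ∂discreteMeasure m ≤ 1 := by
    rw [← MeasureTheory.ofReal_integral_norm_eq_lintegral_enorm (integrable_coeFn _)]
    exact ENNReal.ofReal_le_one.2 h1
  have h3 := (lintegral_enorm_sq_rpow_le (MeasureTheory.Lp.aestronglyMeasurable (u : L2 m)) hp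
    h2).trans (hS.2 u)
  have h4 : ∫⁻ x, ‖(u : L2 m) x‖ₑ ^ 2 ∂discreteMeasure m = ENNReal.ofReal (‖(u : L2 m)‖ ^ 2) := by
    rw [ENNReal.ofReal_pow (norm_nonneg _), ofReal_norm, MeasureTheory.Lp.enorm_def,
      MeasureTheory.eLpNorm_eq_lintegral_rpow_enorm_toReal two_ne_zero ENNReal.ofNat_ne_top,
      ← ENNReal.rpow_natCast, ← ENNReal.rpow_mul]
    norm_num
  rw [h4, ENNReal.ofReal_rpow_of_nonneg (by positivity) (by positivity)] at h3
  exact (ENNReal.ofReal_le_ofReal_iff (mul_nonneg hS.1 (Q.nonneg u))).1 h3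

end DirichletForm

/-! ### Discrete decay and the on-diagonal heat kernel bound -/

/-- A Bernoulli type inequality for negative exponents. -/
theorem one_add_rpow_neg_le {α y : ℝ} (hα : 0 < α) (hy : 0 ≤ y) :
    (1 + y) ^ (-α) ≤ 1 - α * y / (1 + (1 + α) * y) := by
  have h1 : (0 : ℝ) < 1 + y := by linarith
  have h2 : y / (1 + y) ≤ Real.log (1 + y) := by
    have := Real.one_sub_inv_le_log_of_pos h1
    refine le_trans (le_of_eq ?_) this
    field_simp
    ring
  have h3 : 1 + α * (y / (1 + y)) ≤ (1 + y) ^ α := by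
    rw [Real.rpow_def_of_pos h1]
    have := Real.add_one_le_exp (Real.log (1 + y) * α)
    nlinarith
  have h4 : 0 < 1 + α * (y / (1 + y)) := by positivity
  rw [Real.rpow_neg h1.le]
  refine (inv_anti₀ h4 h3).trans (le_of_eq ?_)
  have h5 : 1 + (1 + α) * y ≠ 0 := by positivity
  have h6 : 1 + y + α * y ≠ 0 := by positivity
  field_simp
  ring

/-- Decay of the solutions of the implicit Euler scheme for `a' = -c a^{1 + α}`. -/
theorem rpow_neg_ge_of_forall_succ_le {a : ℕ → ℝ} {α c : ℝ} (hα : 0 < α) (hc : 0 < c)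
    (ha : ∀ n, 0 < a n) (h : ∀ n, a (n + 1) + c * a (n + 1) ^ (1 + α) ≤ a n) (n : ℕ) :
    n * (α * c / (1 + (1 + α) * (c * a 0 ^ α))) ≤ a n ^ (-α) := by
  have hanti : Antitone a := antitone_nat_of_succ_le fun n => by
    have := Real.rpow_nonneg (ha (n + 1)).le (1 + α)
    nlinarith [h n]
  have ha0 := Real.rpow_nonneg (ha 0).le α
  induction n with
  | zero => simpa using Real.rpow_nonneg (ha 0).le (-α)
  | succ n ih =>
    set b := a (n + 1) with hb
    have hbpos : 0 < b := ha _
    set y := c * b ^ α with hy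
    have hy0 : 0 ≤ y := mul_nonneg hc.le (Real.rpow_nonneg hbpos.le _)
    have h1 : b * (1 + y) ≤ a n := by
      have := h n
      rw [← hb, Real.rpow_add hbpos, Real.rpow_one] at this
      rw [hy]
      linarith
    have h2 : a n ^ (-α) ≤ b ^ (-α) * (1 + y) ^ (-α) := by
      rw [← Real.mul_rpow hbpos.le (by linarith)]
      exact Real.rpow_le_rpow_of_nonpos (by positivity) h1 (by linarith)
    have h3 : b ^ (-α) * (1 + y) ^ (-α) ≤ b ^ (-α) * (1 - α * y / (1 + (1 + α) * y)) :=
      mul_le_mul_of_nonneg_left (one_add_rpow_neg_le hα hy0) (Real.rpow_nonneg hbpos.le _)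
    have h4 : b ^ (-α) * y = c := by
      rw [hy, mul_left_comm, ← Real.rpow_add hbpos]
      simp
    have h5 : b ^ (-α) * (1 - α * y / (1 + (1 + α) * y)) =
        b ^ (-α) - α * c / (1 + (1 + α) * y) := by
      rw [← h4]
      ring
    -- The sequence decreases, so the denominator is bounded uniformly by its value at `a 0`. This
    -- correction disappears in the limit of small steps c → 0.
    have h6 : α * c / (1 + (1 + α) * (c * a 0 ^ α)) ≤ α * c / (1 + (1 + α) * y) := by
      have h7 : y ≤ c * a 0 ^ α := mul_le_mul_of_nonneg_left
        (Real.rpow_le_rpow hbpos.le (hanti (Nat.zero_le _)) hα.le) hc.le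
      gcongr
    push_cast
    linarith

namespace DirichletForm

variable {X : Type*} [Countable X] [MeasurableSpace X] [DiscreteMeasurableSpace X] {m : X → ℝ}
  {Q : DirichletForm m}

omit [Countable X] in
theorem integral_norm_resolventOne_pow_pointMass_le (Q : DirichletForm m) (hm : ∀ x, 0 < m x)
    [MeasureTheory.IsFiniteMeasure (discreteMeasure m)] (x : X) (n : ℕ) :
    ∫ y, ‖(Q.resolventOne ^ n) (pointMass m x) y‖ ∂discreteMeasure m ≤ 1 := by
  induction n with
  | zero => exact (integral_norm_pointMass hm x).le
  | succ n ih =>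
    rw [pow_succ', mul_apply_eq_comp]
    exact (Q.integral_norm_resolventOne_le hm _).trans ih

-- One Euler step for sL: the energy inequality combined with Nash, which applies because the
-- iterates of the point mass keep ℓ¹ norm at most 1.
omit [Countable X] in
theorem SobolevWith.resolventOne_pow_pointMass (hm : ∀ x, 0 < m x)
    [MeasureTheory.IsFiniteMeasure (discreteMeasure m)] {p : ℝ≥0∞} (hp : 2 < p) {S : ℝ}
    (hS : Q.SobolevWith p S) (hS0 : 0 < S) {s : ℝ} (hs : 0 < s) (x : X) (n : ℕ) :
    ‖((Q.scale s hs).resolventOne ^ (n + 1)) (pointMass m x)‖ ^ 2 +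
      2 * s / S * (‖((Q.scale s hs).resolventOne ^ (n + 1)) (pointMass m x)‖ ^ 2) ^
        (1 + (1 - 2 / p).toReal) ≤
      ‖((Q.scale s hs).resolventOne ^ n) (pointMass m x)‖ ^ 2 := by
  have h1 := integral_norm_resolventOne_pow_pointMass_le (Q.scale s hs) hm x (n + 1)
  rw [pow_succ' _ n, mul_apply_eq_comp] at h1 ⊢
  set f := ((Q.scale s hs).resolventOne ^ n) (pointMass m x) with hf
  have h2 := (Q.scale s hs).norm_resolventOne_sq_add_le f
  set u : Q.domain :=
    ⟨(Q.scale s hs).resolventOne f, (Q.scale s hs).resolventOne_mem_domain f⟩ with hu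
  have h3 : (Q.scale s hs).quad ⟨(Q.scale s hs).resolventOne f,
      (Q.scale s hs).resolventOne_mem_domain f⟩ = s * Q.quad u := Complex.re_ofReal_mul _ _
  rw [h3] at h2
  have h4 := hS.nash hp u h1
  refine le_trans (add_le_add_right ?_ _) h2
  rw [div_mul_eq_mul_div, div_le_iff₀ hS0]
  calc 2 * s * (‖(u : L2 m)‖ ^ 2) ^ (1 + (1 - 2 / p).toReal) ≤ 2 * s * (S * Q.quad u) := by gcongr
    _ = _ := by ring

/-- The on-diagonal bound for the heat kernel. -/
theorem SobolevWith.norm_heatSemigroup_pointMass_le (hm : ∀ x, 0 < m x)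
    [MeasureTheory.IsFiniteMeasure (discreteMeasure m)] {p : ℝ≥0∞} (hp : 2 < p) {S : ℝ}
    (hS : Q.SobolevWith p S) (hS0 : 0 < S) {t : ℝ} (ht : 0 < t) (x : X) :
    ‖Q.heatSemigroup t (pointMass m x)‖ ^ 2 ≤
      (S / (2 * (1 - 2 / p).toReal * t)) ^ (1 / (1 - 2 / p).toReal) := by
  set α := (1 - 2 / p).toReal with hαdef
  have hα : 0 < α := by
    rw [hαdef, ENNReal.toReal_pos_iff]
    refine ⟨tsub_pos_of_lt ?_, lt_of_le_of_lt tsub_le_self ENNReal.one_lt_top⟩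
    exact ENNReal.div_lt_of_lt_mul (by simpa using hp)
  have hcomp := hS.isCompactOperator_incl hm hp
  set δ := pointMass m x with hδ
  set A : ℝ := (‖δ‖ ^ 2) ^ α with hA
  have hA0 : 0 ≤ A := by positivity
  set a : ℕ → ℝ := fun n =>
    ‖((Q.scale (t / (n + 1)) (by positivity)).resolventOne ^ (n + 1)) δ‖ ^ 2 with ha
  have hlim : Filter.Tendsto a Filter.atTop (nhds (‖Q.heatSemigroup t δ‖ ^ 2)) :=
    ((Q.tendsto_resolventOne_scale_pow hcomp ht δ).norm.pow 2)
  set c : ℕ → ℝ := fun n => 2 * (t / (n + 1)) / S with hc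
  -- These are n + 1 Euler steps of length t/(n + 1). Since `c n` → 0, the factor 1 + (1 + α) `c n`
  -- A tends to 1.
  have hbound : ∀ n : ℕ, a n ≤ (S * (1 + (1 + α) * (c n * A)) / (2 * α * t)) ^ (1 / α) := fun n => by
    have hs : 0 < t / (n + 1 : ℝ) := by positivity
    have hcn : 0 < c n := by positivity
    have hpos : ∀ k, 0 < ‖((Q.scale _ hs).resolventOne ^ k) δ‖ ^ 2 := fun k => by
      have h0 : ((Q.scale _ hs).resolventOne ^ k) δ ≠ 0 := by
        induction k with
        | zero => exact pointMass_ne_zero hm x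
        | succ k ih =>
          rw [pow_succ', mul_apply_eq_comp]
          exact fun h => ih ((Q.scale _ hs).resolventOne_injective (h.trans (map_zero _).symm))
      positivity
    have h := rpow_neg_ge_of_forall_succ_le (a := fun k => ‖((Q.scale _ hs).resolventOne ^ k) δ‖ ^ 2)
      hα hcn hpos (fun k => hS.resolventOne_pow_pointMass hm hp hS0 hs x k) (n + 1)
    have hap : 0 < a n := hpos (n + 1)
    change _ ≤ a n ^ (-α) at h
    have h1 : ((n + 1 : ℕ) : ℝ) * (α * c n / (1 + (1 + α) * (c n * A))) =
        (S * (1 + (1 + α) * (c n * A)) / (2 * α * t))⁻¹ := by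
      have h2 : ((n + 1 : ℕ) : ℝ) * c n = 2 * t / S := by
        simp only [hc]
        push_cast
        field_simp
      rw [inv_div, ← mul_div_assoc, mul_left_comm, h2]
      field_simp
    have h0 : (‖((Q.scale _ hs).resolventOne ^ 0) δ‖ ^ 2) ^ α = A := by simp [hA]
    simp only [h0] at h
    rw [h1, Real.rpow_neg hap.le, inv_le_inv₀ (by positivity) (by positivity)] at h
    have h3 := Real.rpow_le_rpow (by positivity) h (one_div_nonneg.2 hα.le)
    rwa [← Real.rpow_mul hap.le, mul_one_div_cancel hα.ne', Real.rpow_one] at h3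
  have hclim : Filter.Tendsto c Filter.atTop (nhds 0) := by
    have h1 := (tendsto_one_div_add_atTop_nhds_zero_nat (𝕜 := ℝ)).const_mul (2 * t / S)
    rw [mul_zero] at h1
    refine h1.congr fun n => ?_
    simp only [hc]
    field_simp
  have hlim2 : Filter.Tendsto (fun n => (S * (1 + (1 + α) * (c n * A)) / (2 * α * t)) ^ (1 / α))
      Filter.atTop (nhds ((S * (1 + (1 + α) * (0 * A)) / (2 * α * t)) ^ (1 / α))) :=
    ((((((hclim.mul_const A).const_mul (1 + α)).const_add 1).const_mul S).div_const _).rpow_const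
      (Or.inr (by positivity)))
  have := le_of_tendsto_of_tendsto' hlim hlim2 hbound
  simpa using this

end DirichletForm

/-! ### Spans of eigenspaces and counting of eigenvalues -/

section EigenSpan

variable {H : Type*} [NormedAddCommGroup H] [InnerProductSpace ℂ H]

/-- The span of the eigenspaces of `A` for real eigenvalues at most `t`. -/
def eigenSpan (A : H →ₗ.[ℂ] H) (t : ℝ) : Submodule ℂ H :=
  ⨆ s : Set.Iic t, opEigenspace A ((s : ℝ) : ℂ)

theorem eigenvalueCount_eq_rank (A : H →ₗ.[ℂ] H) (t : ℝ) :
    eigenvalueCount A t = Module.rank ℂ (eigenSpan A t) := rfl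

theorem eigenSpan_mono (A : H →ₗ.[ℂ] H) : Monotone (eigenSpan A) := fun _ t hst =>
  iSup_le fun r => le_iSup (fun r : Set.Iic t => opEigenspace A ((r : ℝ) : ℂ)) ⟨r, r.2.trans hst⟩

theorem eigenvalueCount_mono (A : H →ₗ.[ℂ] H) : Monotone (eigenvalueCount A) := fun _ _ hst =>
  Submodule.rank_mono (eigenSpan_mono A hst)

theorem le_eigenSpan (A : H →ₗ.[ℂ] H) (t : ℝ) : opEigenspace A (t : ℂ) ≤ eigenSpan A t :=
  le_iSup (fun r : Set.Iic t => opEigenspace A ((r : ℝ) : ℂ)) ⟨t, Set.mem_Iic.2 le_rfl⟩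

/-- A family of subspaces whose `i`-th member has dimension greater than `i` contains an orthonormal
family. -/
theorem exists_orthonormal_mem (V : ℕ → Submodule ℂ H) (k : ℕ)
    (hV : ∀ i < k, ((i + 1 : ℕ) : Cardinal) ≤ Module.rank ℂ (V i)) :
    ∃ v : Fin k → H, Orthonormal ℂ v ∧ ∀ i : Fin k, v i ∈ V i := by
  induction k with
  | zero => exact ⟨Fin.elim0, ⟨fun i => i.elim0, fun i => i.elim0⟩, fun i => i.elim0⟩
  | succ k ih =>
    obtain ⟨v, hv, hvV⟩ := ih fun i hi => hV i (hi.trans k.lt_succ_self)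
    let φ : V k →ₗ[ℂ] (Fin k → ℂ) :=
      LinearMap.pi fun j => (innerSL ℂ (v j)).toLinearMap ∘ₗ (V k).subtype
    -- `V k` has dimension at least k + 1, so some nonzero vector of it is orthogonal to the k
    -- vectors already chosen.
    have hφ : ¬ Function.Injective φ := fun hinj => by
      have h1 := LinearMap.lift_rank_le_of_injective φ hinj
      rw [rank_fun', Fintype.card_fin, Cardinal.lift_natCast] at h1
      have h2 := Cardinal.lift_le.2 (hV k k.lt_succ_self)
      rw [Cardinal.lift_natCast] at h2
      have h3 := h2.trans h1
      rw [Nat.cast_le] at h3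
      omega
    obtain ⟨w, hw, hw0⟩ : ∃ w : V k, φ w = 0 ∧ w ≠ 0 := by
      rw [injective_iff_map_eq_zero] at hφ
      push Not at hφ
      exact hφ
    have hworth : ∀ j, ⟪v j, (w : H)⟫_ℂ = 0 := fun j => congrFun hw j
    have hwne : (w : H) ≠ 0 := fun h => hw0 (Subtype.ext h)
    set e : H := ((‖(w : H)‖⁻¹ : ℝ) : ℂ) • (w : H) with he
    have hen : ‖e‖ = 1 := by
      rw [he, norm_smul, Complex.norm_real, norm_inv, norm_norm,
        inv_mul_cancel₀ (norm_ne_zero_iff.2 hwne)]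
    have heo : ∀ j, ⟪v j, e⟫_ℂ = 0 := fun j => by rw [he, inner_smul_right, hworth, mul_zero]
    refine ⟨Fin.snoc (α := fun _ => H) v e, ⟨fun i => ?_, fun i j hij => ?_⟩, fun i => ?_⟩
    · induction i using Fin.lastCases with
      | last => rwa [Fin.snoc_last]
      | cast i => rw [Fin.snoc_castSucc]; exact hv.1 i
    · induction i using Fin.lastCases with
      | last =>
        induction j using Fin.lastCases with
        | last => exact absurd rfl hij
        | cast j => rw [Fin.snoc_castSucc, Fin.snoc_last, inner_eq_zero_symm, heo]
      | cast i =>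
        induction j using Fin.lastCases with
        | last => rw [Fin.snoc_castSucc, Fin.snoc_last, heo]
        | cast j =>
          rw [Fin.snoc_castSucc, Fin.snoc_castSucc]
          exact hv.2 fun h => hij (by rw [h])
    · induction i using Fin.lastCases with
      | last => rw [Fin.snoc_last]; exact (V k).smul_mem _ w.2
      | cast i => rw [Fin.snoc_castSucc]; exact hvV i

end EigenSpan

namespace ClosedForm

variable {H : Type*} [NormedAddCommGroup H] [InnerProductSpace ℂ H] (Q : ClosedForm H)

theorem inner_eq_zero_of_mem_opEigenspace {r s : ℝ} (hrs : r ≠ s) {u v : H}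
    (hu : u ∈ opEigenspace Q.generator (r : ℂ)) (hv : v ∈ opEigenspace Q.generator (s : ℂ)) :
    ⟪u, v⟫_ℂ = 0 := by
  rw [mem_opEigenspace_iff, graph_generator, mem_generatorGraph] at hu hv
  obtain ⟨hu, hu'⟩ := hu
  obtain ⟨hv, hv'⟩ := hv
  have h1 : Q.form ⟨u, hu⟩ ⟨v, hv⟩ = r * ⟪u, v⟫_ℂ := by
    refine (hu' ⟨v, hv⟩).trans ?_
    rw [inner_smul_left, Complex.conj_ofReal]
  have h2 : Q.form ⟨v, hv⟩ ⟨u, hu⟩ = s * ⟪v, u⟫_ℂ := by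
    refine (hv' ⟨u, hu⟩).trans ?_
    rw [inner_smul_left, Complex.conj_ofReal]
  have h3 := Q.hermitian ⟨u, hu⟩ ⟨v, hv⟩
  rw [h1, h2, map_mul, Complex.conj_ofReal, inner_conj_symm] at h3
  have h4 : ((s - r : ℝ) : ℂ) * ⟪u, v⟫_ℂ = 0 := by
    push_cast
    linear_combination h3
  refine (mul_eq_zero.1 h4).resolve_left ?_
  exact_mod_cast sub_ne_zero.2 hrs.symm

theorem eigenSpan_eq_bot_of_neg {t : ℝ} (ht : t < 0) : eigenSpan Q.generator t = ⊥ :=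
  iSup_eq_bot.2 fun s => Q.opEigenspace_eq_bot_of_neg (s.2.trans_lt ht)

theorem eigenvalueCount_nonneg_of_pos {k : ℕ} (hk : 1 ≤ k) {t : ℝ}
    (h : (k : Cardinal) ≤ eigenvalueCount Q.generator t) : 0 ≤ t := by
  by_contra! ht
  rw [eigenvalueCount_eq_rank, Q.eigenSpan_eq_bot_of_neg ht, rank_bot] at h
  have : (k : Cardinal) = 0 := le_antisymm h zero_le
  rw [Nat.cast_eq_zero] at this
  omega

variable [CompleteSpace H]

/-- Split v into orthogonal eigenvectors; each is multiplied by e^{-ts} with s ≤ l. Since v need not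
be an eigenvector itself, no eigenbasis has to be chosen later. -/
theorem exp_mul_norm_sq_le_of_mem_eigenSpan {t l : ℝ} (ht : 0 < t) {v : H}
    (hv : v ∈ eigenSpan Q.generator l) :
    Real.exp (-t * l) * ‖v‖ ^ 2 ≤ (⟪v, Q.heatSemigroup t v⟫_ℂ).re := by
  rw [Q.re_inner_heatSemigroup_self ht]
  obtain ⟨f, hf, rfl⟩ := (Submodule.mem_iSup_iff_exists_finsupp _ _).1 hv
  have horth : OrthogonalFamily ℂ
      (fun s : Set.Iic l => opEigenspace Q.generator ((s : ℝ) : ℂ))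
      (fun s => (opEigenspace Q.generator ((s : ℝ) : ℂ)).subtypeₗᵢ) :=
    fun s r hsr u v => Q.inner_eq_zero_of_mem_opEigenspace (fun h => hsr (Subtype.ext h)) u.2 v.2
  have h1 := horth.norm_sum (fun s => ⟨f s, hf s⟩) f.support
  have h2 := horth.norm_sum
    (fun s => (Real.exp (-(t / 2) * s) : ℂ) • ⟨f s, hf s⟩) f.support
  simp only [Submodule.coe_subtypeₗᵢ, Submodule.subtype_apply, Submodule.coe_norm,
    Submodule.coe_smul] at h1 h2
  have h3 : Q.heatSemigroup (t / 2) (∑ s ∈ f.support, f s) =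
      ∑ s ∈ f.support, (Real.exp (-(t / 2) * s) : ℂ) • f s := by
    rw [map_sum]
    exact Finset.sum_congr rfl fun s _ =>
      Q.heatSemigroup_apply_of_mem_opEigenspace (half_pos ht) (hf s)
  change Real.exp (-t * l) * ‖∑ s ∈ f.support, f s‖ ^ 2 ≤
    ‖Q.heatSemigroup (t / 2) (∑ s ∈ f.support, f s)‖ ^ 2
  rw [h3, h2, h1, Finset.mul_sum]
  refine Finset.sum_le_sum fun s _ => ?_
  rw [norm_smul, mul_pow, Complex.norm_real, Real.norm_of_nonneg (Real.exp_pos _).le,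
    ← Real.exp_nat_mul]
  refine mul_le_mul_of_nonneg_right (Real.exp_le_exp.2 ?_) (sq_nonneg _)
  have : (s : ℝ) ≤ l := s.2
  push_cast
  nlinarith

theorem isTraceClass_heatSemigroup_of_sum_le {t : ℝ} (ht : 0 < t) {M : ℝ}
    (hM : ∀ (w : Set H) (v : w → H), Orthonormal ℂ v → ∀ s : Finset w,
      ∑ i ∈ s, (⟪v i, Q.heatSemigroup t (v i)⟫_ℂ).re ≤ M) :
    IsTraceClass (Q.heatSemigroup t) := by
  intro w b
  rw [CFC.abs_of_nonneg _ (Q.heatSemigroup_nonneg t)]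
  refine summable_of_sum_le (fun i => ?_) (hM w b b.orthonormal)
  rw [Q.re_inner_heatSemigroup_self ht]
  positivity

theorem finiteDimensional_opEigenspace (hQ : IsCompactOperator Q.incl) (z : ℂ) :
    FiniteDimensional ℂ (opEigenspace Q.generator z) := by
  by_cases hbot : opEigenspace Q.generator z = ⊥
  · rw [hbot]
    infer_instance
  obtain ⟨u, hu, hne⟩ := (Submodule.ne_bot_iff _).1 hbot
  have h0 : (1 + z) ≠ 0 := fun h0 => by
    rw [mem_opEigenspace_iff_resolventOne, h0, zero_smul, map_zero] at hu
    exact hne hu.symm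
  have := ContinuousLinearMap.finite_dimensional_eigenspace (Q.isCompactOperator_resolventOne hQ)
    (1 + z)⁻¹ (inv_ne_zero h0)
  refine Submodule.finiteDimensional_of_le
    (S₂ := Module.End.eigenspace Q.resolventOne.toLinearMap (1 + z)⁻¹) fun v hv => ?_
  rw [mem_opEigenspace_iff_resolventOne, map_smul] at hv
  rw [Module.End.mem_eigenspace_iff, eq_inv_smul_iff₀ h0]
  exact hv

/-- There are as many eigenvalues as the dimension allows. -/
theorem exists_le_eigenvalueCount (hQ : IsCompactOperator Q.incl) {k : ℕ}
    (hk : (k : Cardinal) ≤ Module.rank ℂ H) :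
    ∃ t, (k : Cardinal) ≤ eigenvalueCount Q.generator t := by
  have hsup : (⨆ s : ℝ, opEigenspace Q.generator (s : ℂ)) ≤ ⨆ t, eigenSpan Q.generator t :=
    iSup_mono fun s => le_eigenSpan _ s
  have hW : (k : Cardinal) ≤ Module.rank ℂ ↥(⨆ t, eigenSpan Q.generator t) := by
    -- If the span of all eigenvectors had dimension below k, it would be closed as well as dense,
    -- hence all of H.
    by_contra! hlt
    have hfin : FiniteDimensional ℂ ↥(⨆ t, eigenSpan Q.generator t) :=
      Module.rank_lt_aleph0_iff.1 (hlt.trans Cardinal.natCast_lt_aleph0)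
    have htop : (⨆ t, eigenSpan Q.generator t) = ⊤ := by
      rw [← (Submodule.closed_of_finiteDimensional
        (⨆ t, eigenSpan Q.generator t)).submodule_topologicalClosure_eq,
        ← Submodule.dense_iff_topologicalClosure_eq_top]
      exact (Q.dense_iSup_opEigenspace hQ).mono hsup
    rw [htop, rank_top] at hlt
    exact absurd hk (not_le.2 hlt)
  obtain ⟨s, hs, hli⟩ := le_rank_iff_exists_linearIndependent_finset.1 hW
  -- The eigenspans increase with t, so k independent vectors of their union already lie in a single
  -- one.
  have hdir : Directed (· ≤ ·) (eigenSpan Q.generator) := (eigenSpan_mono _).directed_le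
  choose T hT using fun x : ↥(⨆ t, eigenSpan Q.generator t) =>
    (Submodule.mem_iSup_of_directed _ hdir).1 x.2
  obtain ⟨t, ht⟩ := (s.image T).exists_le
  refine ⟨t, ?_⟩
  have hli' : LinearIndependent ℂ
      (fun x : s => (⟨x, eigenSpan_mono _ (ht _ (Finset.mem_image_of_mem T x.2)) (hT x)⟩ :
        eigenSpan Q.generator t)) := by
    refine LinearIndependent.of_comp (eigenSpan Q.generator t).subtype ?_
    exact hli.map' (Submodule.subtype _) (Submodule.ker_subtype _)
  have h := hli'.cardinal_le_rank
  rwa [Cardinal.mk_coe_finset, hs] at h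

end ClosedForm

/-! ### Heat trace bound, trace class property and discreteness of the spectrum -/

namespace DirichletForm

variable {X : Type*} [MeasurableSpace X] {m : X → ℝ} {Q : DirichletForm m}

theorem L2_norm_sq_eq_integral (u : L2 m) :
    ‖u‖ ^ 2 = ∫ x, ‖u x‖ ^ 2 ∂discreteMeasure m := by
  have h : ⟪u, u⟫_ℂ = ((∫ x, ‖u x‖ ^ 2 ∂discreteMeasure m : ℝ) : ℂ) := by
    rw [MeasureTheory.L2.inner_def, ← integral_complex_ofReal]
    congr 1
    funext x
    rw [inner_self_eq_norm_sq_to_K]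
    push_cast
    rfl
  rw [inner_self_eq_norm_sq_to_K] at h
  apply Complex.ofReal_injective
  rw [← h, Complex.ofReal_pow]
  rfl

theorem SobolevWith.mono {p : ℝ≥0∞} {S S' : ℝ} (hS : Q.SobolevWith p S) (h : S ≤ S') :
    Q.SobolevWith p S' :=
  ⟨hS.1.trans h, fun u => (hS.2 u).trans
    (ENNReal.ofReal_le_ofReal (mul_le_mul_of_nonneg_right h (Q.nonneg u)))⟩

/-- Working with constants strictly above the infimum avoids showing that it is attained, and makes
them positive. -/
theorem Sobolev.sobolevWith_of_lt {p : ℝ≥0∞} (h : Q.Sobolev p) {S : ℝ}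
    (hS : Q.sobolevConst p < S) : Q.SobolevWith p S := by
  obtain ⟨S', hS', hlt⟩ := exists_lt_of_csInf_lt h hS
  exact SobolevWith.mono hS' hlt.le

theorem sobolevConst_nonneg (p : ℝ≥0∞) : 0 ≤ Q.sobolevConst p :=
  Real.sInf_nonneg fun _ hS => hS.1

variable [Countable X] [DiscreteMeasurableSpace X]

/-- The bound for the trace of the heat semigroup. -/
theorem SobolevWith.sum_re_inner_heatSemigroup_le (hm : ∀ x, 0 < m x)
    [MeasureTheory.IsFiniteMeasure (discreteMeasure m)] {p : ℝ≥0∞} (hp : 2 < p) {S : ℝ}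
    (hS : Q.SobolevWith p S) (hS0 : 0 < S) {t : ℝ} (ht : 0 < t) {ι : Type*} {v : ι → L2 m}
    (hv : Orthonormal ℂ v) (s : Finset ι) :
    ∑ i ∈ s, (⟪v i, Q.heatSemigroup t (v i)⟫_ℂ).re ≤ (discreteMeasure m).real Set.univ *
      (S / ((1 - 2 / p).toReal * t)) ^ (1 / (1 - 2 / p).toReal) := by
  have hint : ∀ u : L2 m, MeasureTheory.Integrable (fun x => ‖u x‖ ^ 2) (discreteMeasure m) :=
    fun u => (MeasureTheory.Lp.memLp u).integrable_norm_pow two_ne_zero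
  have hpt : ∀ x, ∑ i ∈ s, ‖Q.heatSemigroup (t / 2) (v i) x‖ ^ 2 ≤
      (S / ((1 - 2 / p).toReal * t)) ^ (1 / (1 - 2 / p).toReal) := fun x => by
    have h1 := hS.norm_heatSemigroup_pointMass_le hm hp hS0 (half_pos ht) x
    have h2 : 2 * (1 - 2 / p).toReal * (t / 2) = (1 - 2 / p).toReal * t := by ring
    rw [h2] at h1
    -- The value of e^{-tL/2} v_i at x is ⟨e^{-tL/2} δ_x, v_i⟩, so Bessel's inequality bounds the
    -- sum by ‖e^{-tL/2} δ_x‖².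
    refine le_trans ?_ ((hv.sum_inner_products_le _ (s := s)).trans h1)
    refine Finset.sum_le_sum fun i _ => le_of_eq ?_
    rw [← inner_pointMass hm, ← ContinuousLinearMap.adjoint_inner_left,
      (Q.isSelfAdjoint_heatSemigroup _).adjoint_eq, norm_inner_symm]
  calc ∑ i ∈ s, (⟪v i, Q.heatSemigroup t (v i)⟫_ℂ).re
      = ∫ x, ∑ i ∈ s, ‖Q.heatSemigroup (t / 2) (v i) x‖ ^ 2 ∂discreteMeasure m := by
        rw [MeasureTheory.integral_finsetSum _ fun i _ => hint _]
        refine Finset.sum_congr rfl fun i _ => ?_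
        rw [Q.re_inner_heatSemigroup_self ht, L2_norm_sq_eq_integral]
    _ ≤ ∫ _, (S / ((1 - 2 / p).toReal * t)) ^ (1 / (1 - 2 / p).toReal) ∂discreteMeasure m :=
        MeasureTheory.integral_mono (MeasureTheory.integrable_finsetSum _ fun i _ => hint _)
          (MeasureTheory.integrable_const _) hpt
    _ = _ := by rw [MeasureTheory.integral_const, smul_eq_mul]

theorem SobolevWith.isTraceClass_heatSemigroup (hm : ∀ x, 0 < m x)
    [MeasureTheory.IsFiniteMeasure (discreteMeasure m)] {p : ℝ≥0∞} (hp : 2 < p) {S : ℝ}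
    (hS : Q.SobolevWith p S) (hS0 : 0 < S) {t : ℝ} (ht : 0 < t) :
    IsTraceClass (Q.heatSemigroup t) :=
  Q.isTraceClass_heatSemigroup_of_sum_le ht fun _ _ hv s =>
    hS.sum_re_inner_heatSemigroup_le hm hp hS0 ht hv s

theorem SobolevWith.sum_exp_le (hm : ∀ x, 0 < m x)
    [MeasureTheory.IsFiniteMeasure (discreteMeasure m)] {p : ℝ≥0∞} (hp : 2 < p) {S : ℝ}
    (hS : Q.SobolevWith p S) (hS0 : 0 < S) {t : ℝ} (ht : 0 < t) {ι : Type*} {v : ι → L2 m}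
    (hv : Orthonormal ℂ v) (l : ι → ℝ) (hl : ∀ i, v i ∈ eigenSpan Q.generator (l i))
    (s : Finset ι) :
    ∑ i ∈ s, Real.exp (-t * l i) ≤ (discreteMeasure m).real Set.univ *
      (S / ((1 - 2 / p).toReal * t)) ^ (1 / (1 - 2 / p).toReal) := by
  refine le_trans (Finset.sum_le_sum fun i _ => ?_)
    (hS.sum_re_inner_heatSemigroup_le hm hp hS0 ht hv s)
  have := Q.exp_mul_norm_sq_le_of_mem_eigenSpan ht (hl i)
  rwa [hv.1 i, one_pow, mul_one] at this

/-- Unit eigenvectors for distinct eigenvalues are orthonormal, and each one with eigenvalue at most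
l contributes at least e^{-l} to the trace at time 1. -/
theorem SobolevWith.finite_eigenvalues_le (hm : ∀ x, 0 < m x)
    [MeasureTheory.IsFiniteMeasure (discreteMeasure m)] {p : ℝ≥0∞} (hp : 2 < p) {S : ℝ}
    (hS : Q.SobolevWith p S) (hS0 : 0 < S) (l : ℝ) :
    {s : ℝ | s ≤ l ∧ opEigenspace Q.generator (s : ℂ) ≠ ⊥}.Finite := by
  set E := {s : ℝ | s ≤ l ∧ opEigenspace Q.generator (s : ℂ) ≠ ⊥} with hE
  have hex : ∀ s : E, ∃ v ∈ opEigenspace Q.generator ((s : ℝ) : ℂ), ‖v‖ = 1 := fun s => by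
    obtain ⟨u, hu, hne⟩ := (Submodule.ne_bot_iff _).1 s.2.2
    refine ⟨((‖u‖⁻¹ : ℝ) : ℂ) • u, Submodule.smul_mem _ _ hu, ?_⟩
    rw [norm_smul, Complex.norm_real, norm_inv, norm_norm, inv_mul_cancel₀ (norm_ne_zero_iff.2 hne)]
  choose v hv hvn using hex
  have horth : Orthonormal ℂ v := ⟨hvn, fun s r hsr =>
    Q.inner_eq_zero_of_mem_opEigenspace (fun h => hsr (Subtype.ext h)) (hv s) (hv r)⟩
  have hbound := hS.sum_exp_le hm hp hS0 one_pos horth (fun _ => l)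
    (fun s => eigenSpan_mono _ s.2.1 (le_eigenSpan _ _ (hv s)))
  set M := (discreteMeasure m).real Set.univ *
      (S / ((1 - 2 / p).toReal * 1)) ^ (1 / (1 - 2 / p).toReal) with hM
  by_contra hinf
  have : Infinite E := Set.infinite_coe_iff.2 hinf
  obtain ⟨n, hn⟩ := exists_nat_gt (M / Real.exp (-1 * l))
  obtain ⟨F, hF⟩ := Infinite.exists_subset_card_eq E n
  have h := hbound F
  rw [Finset.sum_const, hF, nsmul_eq_mul, ← le_div_iff₀ (Real.exp_pos _)] at h
  exact absurd h (not_le.2 hn)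

theorem SobolevWith.hasDiscreteSpectrum (hm : ∀ x, 0 < m x)
    [MeasureTheory.IsFiniteMeasure (discreteMeasure m)] {p : ℝ≥0∞} (hp : 2 < p) {S : ℝ}
    (hS : Q.SobolevWith p S) (hS0 : 0 < S) : HasDiscreteSpectrum Q.generator := by
  have hcomp := hS.isCompactOperator_incl hm hp
  have hreal : ∀ w ∈ opSpectrum Q.generator,
      opEigenspace Q.generator w ≠ ⊥ ∧ w = (w.re : ℂ) := fun w hw => by
    have h := Q.opEigenspace_ne_bot_of_mem_opSpectrum hcomp hw
    obtain ⟨u, hu, hne⟩ := (Submodule.ne_bot_iff _).1 h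
    exact ⟨h, (Q.eigenvalue_real_nonneg hu hne).2⟩
  intro z hz
  obtain ⟨hzne, hzre⟩ := hreal z hz
  refine ⟨?_, hzne, Q.finiteDimensional_opEigenspace hcomp z⟩
  -- The other eigenvalues up to z + 1 form a finite, hence closed, set. The radius is then capped
  -- at 1 to stay in this window.
  have hfin := (hS.finite_eigenvalues_le hm hp hS0 (z.re + 1)).subset
    (Set.sdiff_subset (t := {z.re}))
  obtain ⟨ε, hε, hball⟩ := Metric.isOpen_iff.1 hfin.isClosed.isOpen_compl z.re (by simp)
  refine ⟨min ε 1, lt_min hε one_pos, fun w hw hwz => ?_⟩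
  obtain ⟨hwne, hwre⟩ := hreal w hw
  have hdist : dist w.re z.re < min ε 1 := by
    refine lt_of_le_of_lt ?_ hwz
    rw [Real.dist_eq, dist_eq_norm, ← Complex.sub_re]
    exact Complex.abs_re_le_norm _
  have h1 := hball (Metric.mem_ball.2 (hdist.trans_le (min_le_left _ _)))
  have h2 : w.re ≤ z.re + 1 := by
    have := (le_abs_self _).trans_lt (hdist.trans_le (min_le_right _ _))
    linarith
  by_contra hne
  refine h1 ⟨⟨h2, ?_⟩, fun h => hne ?_⟩
  · rwa [← hwre]
  · rw [hwre, hzre, Set.mem_singleton_iff.1 h]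

-- The point masses are orthogonal and nonzero. This is where k ≤ |X| enters: it makes the set
-- defining the k-th eigenvalue nonempty.
omit [Countable X] in
theorem natCast_le_rank_L2 (hm : ∀ x, 0 < m x) {k : ℕ} (hk : (k : ℕ∞) ≤ ENat.card X) :
    (k : Cardinal) ≤ Module.rank ℂ (L2 m) := by
  have hli : LinearIndependent ℂ (pointMass m) := by
    refine linearIndependent_of_ne_zero_of_inner_eq_zero (pointMass_ne_zero hm) fun x y hxy => ?_
    change ⟪pointMass m x, pointMass m y⟫_ℂ = 0
    rw [inner_pointMass hm, pointMass_apply hm]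
    exact Set.indicator_of_notMem (by simpa using hxy) _
  have h1 := hli.cardinal_lift_le_rank
  have h2 : (k : Cardinal) ≤ Cardinal.mk X := by
    rw [ENat.card] at hk
    exact (Cardinal.natCast_le_toENat).1 hk
  have h3 := (Cardinal.lift_le.2 h2).trans h1
  rw [Cardinal.lift_natCast] at h3
  simpa using h3

end DirichletForm

/-! ### Lower bounds for the eigenvalues -/

/-- Optimization of the exponential bound in `t`. -/
theorem rpow_le_of_forall_mul_exp_le {k μ S B α : ℝ} (hk : 0 < k) (hμ : 0 < μ) (hS : 0 < S)
    (hα : 0 < α) (h : ∀ t, 0 < t → k * Real.exp (-t * B) ≤ μ * (S / (α * t)) ^ (1 / α)) :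
    (k / μ) ^ α ≤ B * (Real.exp 1 * S) := by
  set r := (k / μ) ^ α with hr
  have hr0 : 0 < r := by positivity
  -- The time giving the largest lower bound for B: then S/(αt) = r/e, and the hypothesis becomes tB
  -- ≥ 1/α.
  set t := S / α * Real.exp 1 / r with ht
  have ht0 : 0 < t := by positivity
  have h1 : S / (α * t) = r * Real.exp (-1) := by
    rw [ht, Real.exp_neg]
    field_simp
  have h2 : (S / (α * t)) ^ (1 / α) = k / μ * Real.exp (-(1 / α)) := by
    rw [h1, Real.mul_rpow hr0.le (Real.exp_pos _).le, hr, ← Real.rpow_mul (by positivity),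
      mul_one_div_cancel hα.ne', Real.rpow_one, ← Real.exp_mul, neg_one_mul]
  have h3 := h t ht0
  have h4 : μ * (k / μ * Real.exp (-(1 / α))) = k * Real.exp (-(1 / α)) := by
    field_simp
  rw [h2, h4, mul_le_mul_iff_right₀ hk, Real.exp_le_exp] at h3
  have h5 : 1 / α ≤ t * B := by linarith
  have h6 : t * B = (B * (Real.exp 1 * S)) / (α * r) := by
    rw [ht]
    field_simp
  rw [h6, div_le_div_iff₀ hα (by positivity)] at h5
  nlinarith

namespace DirichletForm

variable {X : Type*} [Countable X] [MeasurableSpace X] [DiscreteMeasurableSpace X] {m : X → ℝ}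
  {Q : DirichletForm m}

/-- The ε makes it unnecessary to know that the infimum defining an eigenvalue is attained: at level
λ_i + ε the eigenspan has dimension at least i, which yields orthonormal test vectors for the trace
bound. -/
theorem SobolevWith.rpow_le_mean_eigenvalue (hm : ∀ x, 0 < m x)
    [MeasureTheory.IsFiniteMeasure (discreteMeasure m)] {p : ℝ≥0∞} (hp : 2 < p) {S : ℝ}
    (hS : Q.SobolevWith p S) (hS0 : 0 < S) {k : ℕ} (hk : 1 ≤ k) (hkX : (k : ℕ∞) ≤ ENat.card X)
    {ε : ℝ} (hε : 0 < ε) :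
    ((k : ℝ) / (discreteMeasure m).real Set.univ) ^ (1 - 2 / p).toReal ≤
      (1 / (k : ℝ) * ∑ i ∈ Finset.Icc 1 k, eigenvalueNth Q.generator i + ε) *
        (Real.exp 1 * S) := by
  have hcomp := hS.isCompactOperator_incl hm hp
  have hα : 0 < (1 - 2 / p).toReal := by
    rw [ENNReal.toReal_pos_iff]
    refine ⟨tsub_pos_of_lt ?_, lt_of_le_of_lt tsub_le_self ENNReal.one_lt_top⟩
    exact ENNReal.div_lt_of_lt_mul (by simpa using hp)
  have hk0 : (0 : ℝ) < k := by exact_mod_cast hk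
  have hμ : 0 < (discreteMeasure m).real Set.univ := by
    have : Nonempty X := by
      by_contra hX
      rw [not_nonempty_iff] at hX
      rw [ENat.card_eq_zero_iff_empty X |>.2 hX] at hkX
      have := Nat.cast_eq_zero.1 (le_antisymm hkX zero_le)
      omega
    obtain ⟨x⟩ := this
    refine lt_of_lt_of_le (hm x) ?_
    have h := MeasureTheory.measureReal_mono (μ := discreteMeasure m) (Set.subset_univ {x})
    rwa [MeasureTheory.measureReal_def, discreteMeasure_singleton,
      ENNReal.toReal_ofReal (hm x).le] at h
  obtain ⟨T, hT⟩ := Q.exists_le_eigenvalueCount hcomp (natCast_le_rank_L2 hm hkX)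
  have hcount : ∀ i < k, ((i + 1 : ℕ) : Cardinal) ≤
      Module.rank ℂ (eigenSpan Q.generator (eigenvalueNth Q.generator (i + 1) + ε)) := fun i hi => by
    obtain ⟨t, ht, hlt⟩ := exists_lt_of_csInf_lt
      (s := {t : ℝ | ((i + 1 : ℕ) : Cardinal) ≤ eigenvalueCount Q.generator t})
      ⟨T, (Nat.cast_le.2 (Nat.succ_le_of_lt hi)).trans hT⟩
      (lt_add_of_pos_right (eigenvalueNth Q.generator (i + 1)) hε)
    exact le_trans ht (eigenvalueCount_mono _ hlt.le)
  obtain ⟨v, hv, hvV⟩ := exists_orthonormal_mem _ k hcount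
  set lam : Fin k → ℝ := fun i => eigenvalueNth Q.generator (i + 1) + ε with hlam
  have hsum : ∑ i, lam i = k * (1 / (k : ℝ) * ∑ i ∈ Finset.Icc 1 k, eigenvalueNth Q.generator i +
      ε) := by
    rw [mul_add, ← mul_assoc, mul_one_div_cancel hk0.ne', one_mul]
    simp only [hlam]
    rw [Finset.sum_add_distrib, Finset.sum_const, Finset.card_univ, Fintype.card_fin, nsmul_eq_mul,
      Fin.sum_univ_eq_sum_range (fun i => eigenvalueNth Q.generator (i + 1)) k]
    congr 1
    rw [Finset.range_eq_Ico, Finset.sum_Ico_add' (fun i => eigenvalueNth Q.generator i) 0 k 1]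
    rfl
  set B := 1 / (k : ℝ) * ∑ i ∈ Finset.Icc 1 k, eigenvalueNth Q.generator i + ε with hB
  refine rpow_le_of_forall_mul_exp_le hk0 hμ hS0 hα fun t ht => ?_
  refine le_trans ?_ (hS.sum_exp_le hm hp hS0 ht hv lam hvV Finset.univ)
  -- Jensen's inequality through the tangent to exp at the mean B; the linear terms sum to zero.
  calc (k : ℝ) * Real.exp (-t * B)
      = ∑ i, Real.exp (-t * B) * (1 + -t * (lam i - B)) := by
        rw [← Finset.mul_sum, Finset.sum_add_distrib, ← Finset.mul_sum, Finset.sum_sub_distrib,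
          hsum]
        simp
        ring
    _ ≤ ∑ i, Real.exp (-t * lam i) := by
        refine Finset.sum_le_sum fun i _ => ?_
        have h1 : -t * lam i = -t * B + -t * (lam i - B) := by ring
        rw [h1, Real.exp_add]
        have h2 := Real.add_one_le_exp (-t * (lam i - B))
        exact mul_le_mul_of_nonneg_left (by linarith) (Real.exp_pos _).le

omit [Countable X] [DiscreteMeasurableSpace X] in
theorem eigenvalueNth_nonneg (Q : DirichletForm m) {k : ℕ} (hk : 1 ≤ k) :
    0 ≤ eigenvalueNth Q.generator k :=
  Real.sInf_nonneg fun _ ht => Q.eigenvalueCount_nonneg_of_pos hk ht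

end DirichletForm

theorem mainTheorem3 {X : Type*} [Countable X] [MeasurableSpace X] [DiscreteMeasurableSpace X]
    (m : X → ℝ) (hm : ∀ x, 0 < m x) (hfin : discreteMeasure m Set.univ < ∞)
    (Q : DirichletForm m) (p : ℝ≥0∞) (hp : 2 < p) (hS : Q.Sobolev p) :
    (∀ t : ℝ, 0 < t → IsTraceClass (Q.heatSemigroup t)) ∧
    HasDiscreteSpectrum Q.generator ∧
    ∀ k : ℕ, 1 ≤ k → (k : ℕ∞) ≤ ENat.card X →
      1 / (Real.exp 1 * Q.sobolevConst p) *
          ((k : ℝ) / (discreteMeasure m).real Set.univ) ^ (1 - 2 / p).toReal ≤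
        1 / (k : ℝ) * ∑ i ∈ Finset.Icc 1 k, eigenvalueNth Q.generator i ∧
      1 / (Real.exp 1 * Q.sobolevConst p) *
          ((k : ℝ) / (discreteMeasure m).real Set.univ) ^ (1 - 2 / p).toReal ≤
        eigenvalueNth Q.generator k := by
  have : MeasureTheory.IsFiniteMeasure (discreteMeasure m) := ⟨hfin⟩
  have hS0 := Q.sobolevConst_nonneg p
  have hSε : ∀ ε : ℝ, 0 < ε → Q.SobolevWith p (Q.sobolevConst p + ε) := fun ε hε =>
    hS.sobolevWith_of_lt (lt_add_of_pos_right _ hε)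
  have hpos : ∀ ε : ℝ, 0 < ε → 0 < Q.sobolevConst p + ε := fun ε hε => by linarith
  refine ⟨fun t ht => (hSε 1 one_pos).isTraceClass_heatSemigroup hm hp (hpos 1 one_pos) ht,
    (hSε 1 one_pos).hasDiscreteSpectrum hm hp (hpos 1 one_pos), fun k hk hkX => ?_⟩
  have hk0 : (0 : ℝ) < k := by exact_mod_cast hk
  have hnonneg : 0 ≤ 1 / (k : ℝ) * ∑ i ∈ Finset.Icc 1 k, eigenvalueNth Q.generator i :=
    mul_nonneg (by positivity) (Finset.sum_nonneg fun i hi =>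
      Q.eigenvalueNth_nonneg (Finset.mem_Icc.1 hi).1)
  have hmean : 1 / (Real.exp 1 * Q.sobolevConst p) *
      ((k : ℝ) / (discreteMeasure m).real Set.univ) ^ (1 - 2 / p).toReal ≤
        1 / (k : ℝ) * ∑ i ∈ Finset.Icc 1 k, eigenvalueNth Q.generator i := by
    set A := 1 / (k : ℝ) * ∑ i ∈ Finset.Icc 1 k, eigenvalueNth Q.generator i with hA
    have hlim : Filter.Tendsto (fun ε : ℝ => (A + ε) * (Real.exp 1 * (Q.sobolevConst p + ε)))
        (nhdsWithin 0 (Set.Ioi 0)) (nhds ((A + 0) * (Real.exp 1 * (Q.sobolevConst p + 0)))) :=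
      tendsto_nhdsWithin_of_tendsto_nhds (Continuous.tendsto (by fun_prop) 0)
    have h := ge_of_tendsto hlim (Filter.eventually_of_mem self_mem_nhdsWithin fun ε hε =>
      (hSε ε hε).rpow_le_mean_eigenvalue hm hp (hpos ε hε) hk hkX hε)
    rw [add_zero, add_zero] at h
    -- If the constant is 0, division by zero makes the left side 0, and nonnegativity of the mean
    -- is enough.
    rcases hS0.eq_or_lt with h0 | h0
    · rw [← h0]
      simpa using hnonneg
    · rw [one_div_mul_eq_div, div_le_iff₀ (by positivity)]
      exact h
  refine ⟨hmean, hmean.trans ?_⟩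
  obtain ⟨T, hT⟩ := Q.exists_le_eigenvalueCount ((hSε 1 one_pos).isCompactOperator_incl hm hp)
    (DirichletForm.natCast_le_rank_L2 hm hkX)
  have hle : ∀ i ∈ Finset.Icc 1 k, eigenvalueNth Q.generator i ≤ eigenvalueNth Q.generator k :=
      fun i hi => by
    rw [Finset.mem_Icc] at hi
    -- A level with at least k eigenvalues below it has at least i of them, so the eigenvalues
    -- increase with the index and the last dominates the mean.
    refine csInf_le_csInf ⟨0, fun t ht => Q.eigenvalueCount_nonneg_of_pos hi.1 ht⟩ ⟨T, hT⟩
      fun t ht => ?_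
    rw [Set.mem_ofPred_eq] at ht ⊢
    exact (Nat.cast_le.2 hi.2).trans ht
  have h := Finset.sum_le_card_nsmul _ _ _ hle
  rw [Nat.card_Icc, Nat.add_sub_cancel, nsmul_eq_mul] at h
  rw [one_div_mul_eq_div, div_le_iff₀ hk0, mul_comm]
  exact h
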